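/- Let $d\in\mathbb{N}$, $N\ge 1$, $h=1/N$, $\lambda>0$. Let $\mathbb{T}^d=\mathbb{R}^d/\mathbb{Z}^d$ and let $L:\mathbb{T}^d\times\mathbb{R}^d\to\mathbb{R}$ be such that $L$ and its derivative $L_x$ are continuous, $L(x,\cdot)$ is convex for every $x$, and for each $a\ge 0$ there is $g(a)\in\mathbb{R}$ with $L(x,v)\ge a|v|+g(a)$ for all $x,v$. Let $\Lambda_N=(h\mathbb{Z}^d)/\mathbb{Z}^d\subset\mathbb{T}^d$. For $\phi:\Lambda_N\to\mathbb{R}$ put $\Delta^{\pm}_{N,i}\phi(x)=h^{-1}(\phi(x\pm he_i)-\phi(x))$ and $\Delta_N\phi(x)=((\Delta^+_{N,i}\phi(x),\Delta^-_{N,i}\phi(x)))_{i=1}^d$. For a tuple of pairs $\xi=((\xi_i^+,\xi_i^-))_{i=1}^d$ and $v\in\mathbb{R}^d$ put $\xi\cdot v=\sum_{i=1}^d(\xi_i^+v_i^++\xi_i^-v_i^-)$, where $v_i^+=\max(v_i,0)$ and $v_i^-=\max(-v_i,0)$. Let $\mathcal{H}_N(x,\xi)=\sup_{v\in\mathbb{R}^d}[\xi\cdot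 v-L(x,v)]$. Let $Q^N(v)$ be the Kolmogorov matrix on $\Lambda_N$ acting by $$Q^N(v)\phi(x)=\sum_{y\in\Lambda_N}Q^N_{x,y}(v)\phi(y)=\sum_{i=1}^d h^{-1}|v_i|\,\big(\phi(x+\operatorname{sgn}(v_i)he_i)-\phi(x)\big).$$ A controlled Markov chain process started at $z\in\Lambda_N$ consists of a filtered probability space $(\Omega,\mathcal{F},\{\mathcal{F}_t\}_{t\ge 0},\mathbb{P})$, an adapted, jointly measurable process $X$ with values in $\Lambda_N$ and $X_0=z$ a.s., and a progressively measurable $\mathbb{R}^d$-valued process $V$ such that, for every $t\ge 0$, $\mathbb{E}\int_0^t|V_s|\,ds<\infty$ and, for every $\phi:\Lambda_N\to\mathbb{R}$, the process $\phi(X_t)-\int_0^tQ^N(V_s)\phi(X_s)\,ds$ is an $\{\mathcal{F}_t\}$-martingale. A motion produced by a stationary feedback strategy $\pi:\Lambda_N\to\mathbb{R}^d$ and the initial state $z$ is a filtered probability space with an adapted, jointly measurable process $X$ with values in $\Lambda_N$, $X_0=z$ a.s., such that the same integrability and martingale conditions hold with $V_s$ replaced by $\pi(X_s)$. The discounted cost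 of $(X,V)$ is $\mathbb{E}\int_0^{\infty}e^{-\lambda t}L(X_t,V_t)\,dt\in(-\infty,+\infty]$. Then the equation $$\lambda\varphi(x)+\mathcal{H}_N(x,(-\Delta_N)\varphi(x))=0,\qquad x\in\Lambda_N,$$ has a unique solution $\varphi:\Lambda_N\to\mathbb{R}$. Moreover: 1. There is a stationary feedback strategy $\pi^*$ with $$\pi^*(x)\in\operatorname*{Argmax}_{v\in\mathbb{R}^d}\big[(-\Delta_N)\varphi(x)\cdot v-L(x,v)\big]\quad\text{for all }x\in\Lambda_N.$$ 2. Every such $\pi^*$ is optimal: for every $z\in\Lambda_N$ there is a motion $X$ produced by $\pi^*$ and the initial state $z$ for which $(X,\pi^*(X))$ is a controlled Markov chain process, and every motion produced by $\pi^*$ and the initial state $z$ satisfies $\mathbb{E}\int_0^\infty e^{-\lambda t}L(X_t,\pi^*(X_t))\,dt=\varphi(z)$. 3. For every $z\in\Lambda_N$ and every controlled Markov chain process started at $z$, $\mathbb{E}\int_0^\infty e^{-\lambda t}L(X_t,V_t)\,dt\ge\varphi(z)$. -/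

import Mathlib

open MeasureTheory ProbabilityTheory
open scoped NNReal ENNReal

universe u

/-- The space `ℝ^d` of velocities, with the Euclidean norm. -/
abbrev Vel (d : ℕ) : Type := EuclideanSpace ℝ (Fin d)

/-- The class `[x] ∈ 𝕋^d = ℝ^d / ℤ^d` of a point `x ∈ ℝ^d`. -/
def toTorus {d : ℕ} (x : EuclideanSpace ℝ (Fin d)) : UnitAddTorus (Fin d) :=
  fun i => ((x i : ℝ) : UnitAddCircle)

/-- The standing assumptions on a Lagrangian `L : 𝕋^d × ℝ^d → ℝ`: `L` and its `x`-derivative are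
continuous, `L` is convex in the velocity and grows superlinearly. The `x`-derivative is taken in
the covering space `ℝ^d` of the torus. -/
structure IsLagrangian {d : ℕ} (L : UnitAddTorus (Fin d) → Vel d → ℝ) : Prop where
  continuous : Continuous fun p : UnitAddTorus (Fin d) × Vel d => L p.1 p.2
  differentiable : ∀ v, Differentiable ℝ fun x : EuclideanSpace ℝ (Fin d) => L (toTorus x) v
  continuous_deriv : Continuous fun p : EuclideanSpace ℝ (Fin d) × Vel d =>
    fderiv ℝ (fun x : EuclideanSpace ℝ (Fin d) => L (toTorus x) p.2) p.1
  convex : ∀ x, ConvexOn ℝ Set.univ (L x)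
  superlinear : ∀ a : ℝ, 0 ≤ a → ∃ g : ℝ, ∀ x v, a * ‖v‖ + g ≤ L x v

/-- The lattice `Λ_N = (N⁻¹ ℤ^d) / ℤ^d`, in the coordinates `k ∈ (ℤ/Nℤ)^d ↦ k / N`. -/
abbrev TorusLattice (d N : ℕ) : Type := Fin d → ZMod N

noncomputable section

namespace TorusLattice

/-- The inclusion `Λ_N ⊆ 𝕋^d`: the point with coordinates `k` is the class of `k / N`. -/
def point {d N : ℕ} [NeZero N] (x : TorusLattice d N) : UnitAddTorus (Fin d) :=
  fun i => ZMod.toAddCircle (x i)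

/-- The inclusion of the lattice into the torus is injective. -/
theorem point_injective {d N : ℕ} [NeZero N] :
    Function.Injective (point : TorusLattice d N → UnitAddTorus (Fin d)) := by
  intro x y h
  funext i
  exact ZMod.toAddCircle_injective N (congrFun h i)

/-- The point with integer coordinates `k` is the class of `k / N`. -/
theorem point_intCast {d N : ℕ} [NeZero N] (k : Fin d → ℤ) :
    point (fun i => (k i : ZMod N)) =
      toTorus (WithLp.toLp 2 fun i => (k i : ℝ) / N) := by
  funext i
  simp [point, toTorus, ZMod.toAddCircle_intCast]

/-- The image of the lattice is `(N⁻¹ ℤ^d) / ℤ^d`. -/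
theorem range_point {d N : ℕ} [NeZero N] :
    Set.range (point : TorusLattice d N → UnitAddTorus (Fin d)) =
      Set.range fun k : Fin d → ℤ => toTorus (WithLp.toLp 2 fun i => (k i : ℝ) / N) := by
  ext t
  constructor
  · rintro ⟨x, rfl⟩
    choose k hk using fun i => ZMod.intCast_surjective (x i)
    exact ⟨k, (point_intCast k).symm.trans (congrArg point (funext hk))⟩
  · rintro ⟨k, rfl⟩
    exact ⟨_, point_intCast k⟩

/-- The lattice vector `h e_i`, where `h = N⁻¹`. -/
def e {d N : ℕ} (i : Fin d) : TorusLattice d N := Pi.single i 1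

/-- The lattice vector `sgn(a) h e_i`. -/
def step {d N : ℕ} (a : ℝ) (i : Fin d) : TorusLattice d N := (SignType.sign a : ℤ) • e i

end TorusLattice

/-- The Kolmogorov matrix `Q^N(v)`: every coordinate `i` contributes a jump from `x` to
`x + sgn(v_i) h e_i` at the rate `N |v_i|`. -/
def kolmogorov {d N : ℕ} (v : Vel d) (x y : TorusLattice d N) : ℝ :=
  ∑ i, (N : ℝ) * |v i| *
    ((if y = x + TorusLattice.step (v i) i then 1 else 0) - (if y = x then 1 else 0))

/-- `Δ_{N,i}^+ φ(x) = (φ(x + h e_i) - φ(x)) / h`. -/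
def diffPlus {d N : ℕ} (φ : TorusLattice d N → ℝ) (x : TorusLattice d N) (i : Fin d) : ℝ :=
  (φ (x + TorusLattice.e i) - φ x) / (N : ℝ)⁻¹

/-- `Δ_{N,i}^- φ(x) = (φ(x - h e_i) - φ(x)) / h`. -/
def diffMinus {d N : ℕ} (φ : TorusLattice d N → ℝ) (x : TorusLattice d N) (i : Fin d) : ℝ :=
  (φ (x - TorusLattice.e i) - φ x) / (N : ℝ)⁻¹

/-- The tuple of pairs `Δ_N φ(x)`. -/
def latticeGrad {d N : ℕ} (φ : TorusLattice d N → ℝ) (x : TorusLattice d N) : Fin d → ℝ × ℝ :=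
  fun i => (diffPlus φ x i, diffMinus φ x i)

/-- The pairing `ξ · v = ∑ i, (ξ_i^+ v_i^+ + ξ_i^- v_i^-)` of a tuple of pairs and a vector, where
`v_i^+` and `v_i^-` are the positive and the negative part of `v_i`. -/
def pairing {d : ℕ} (ξ : Fin d → ℝ × ℝ) (v : Vel d) : ℝ :=
  ∑ i, ((ξ i).1 * max (v i) 0 + (ξ i).2 * max (-v i) 0)

/-- The Kolmogorov matrix acts on functions as `∑ y, Q^N_{x,y}(v) φ(y) = Δ_N φ(x) · v`. -/
theorem sum_kolmogorov_mul {d N : ℕ} [NeZero N] (v : Vel d) (φ : TorusLattice d N → ℝ)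
    (x : TorusLattice d N) :
    ∑ y, kolmogorov v x y * φ y = pairing (latticeGrad φ x) v := by
  simp only [kolmogorov, pairing, latticeGrad, Finset.sum_mul]
  rw [Finset.sum_comm]
  refine Finset.sum_congr rfl fun i _ => ?_
  have h : ∀ y, (N : ℝ) * |v i| * ((if y = x + TorusLattice.step (v i) i then 1 else 0)
      - (if y = x then 1 else 0)) * φ y =
      (if y = x + TorusLattice.step (v i) i then (N : ℝ) * |v i| * φ y else 0) -
      (if y = x then (N : ℝ) * |v i| * φ y else 0) := by
    intro y; split_ifs <;> ring
  simp only [h, Finset.sum_sub_distrib, Finset.sum_ite_eq', Finset.mem_univ, if_true]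
  rcases lt_trichotomy (v i) 0 with hv | hv | hv
  · simp [TorusLattice.step, diffPlus, diffMinus, hv, abs_of_neg, hv.le,
      sub_eq_add_neg]
    ring
  · simp [hv]
  · simp [TorusLattice.step, diffPlus, diffMinus, hv, abs_of_pos, hv.le]
    ring

/-- For `N ≥ 2` the diagonal entries are `-N ∑ j, |v_j|`. -/
theorem kolmogorov_self {d N : ℕ} (hN : 2 ≤ N) (v : Vel d) (x : TorusLattice d N) :
    kolmogorov v x x = -(N : ℝ) * ∑ j, |v j| := by
  have : Fact (1 < N) := ⟨hN⟩
  simp only [kolmogorov, Finset.mul_sum]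
  refine Finset.sum_congr rfl fun i _ => ?_
  by_cases hv : v i = 0
  · simp [hv]
  · have : (TorusLattice.step (v i) i : TorusLattice d N) ≠ 0 := by
      rcases lt_or_gt_of_ne hv with h | h <;> simp [TorusLattice.step, TorusLattice.e, h]
    simp [this]

/-- For `N ≥ 2` the entry at `y = x + sgn(v_i) h e_i ≠ x` is `N |v_i|`. -/
theorem kolmogorov_step {d N : ℕ} (hN : 2 ≤ N) (v : Vel d) (x : TorusLattice d N) (i : Fin d)
    (hv : v i ≠ 0) : kolmogorov v x (x + TorusLattice.step (v i) i) = N * |v i| := by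
  have : Fact (1 < N) := ⟨hN⟩
  have h0 : ∀ j, v j ≠ 0 → (TorusLattice.step (v j) j : TorusLattice d N) j ≠ 0 := by
    intro j hj
    rcases lt_or_gt_of_ne hj with h | h <;> simp [TorusLattice.step, TorusLattice.e, h]
  have h1 : (TorusLattice.step (v i) i : TorusLattice d N) ≠ 0 := fun h => h0 i hv (by rw [h]; rfl)
  rw [kolmogorov, Finset.sum_eq_single i]
  · simp [h1]
  · intro j _ hj
    have h2 : (TorusLattice.step (v i) i : TorusLattice d N) ≠ TorusLattice.step (v j) j := by
      intro h
      apply h0 i hv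
      rw [h]
      simp [TorusLattice.step, TorusLattice.e, Ne.symm hj]
    simp [h1, h2]
  · simp

/-- All the other off-diagonal entries vanish. -/
theorem kolmogorov_eq_zero {d N : ℕ} (v : Vel d) (x y : TorusLattice d N) (hy : y ≠ x)
    (h : ∀ i, y ≠ x + TorusLattice.step (v i) i) : kolmogorov v x y = 0 := by
  simp [kolmogorov, hy, h]

/-- The lattice Hamiltonian `H_N(x, ξ) = sup_v (ξ · v - L(x, v))`. -/
def latticeHamiltonian {d N : ℕ} [NeZero N] (L : UnitAddTorus (Fin d) → Vel d → ℝ)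
    (x : TorusLattice d N) (ξ : Fin d → ℝ × ℝ) : ℝ :=
  ⨆ v : Vel d, (pairing ξ v - L (TorusLattice.point x) v)

/-- `φ` solves the Bellman equation `λ φ(x) + H_N(x, (-Δ_N) φ(x)) = 0` on `Λ_N`. -/
def IsBellmanSolution {d N : ℕ} [NeZero N] (L : UnitAddTorus (Fin d) → Vel d → ℝ) (lam : ℝ)
    (φ : TorusLattice d N → ℝ) : Prop :=
  ∀ x, lam * φ x + latticeHamiltonian L x (-latticeGrad φ x) = 0

/-- The stationary feedback `π` maximizes the Hamiltonian of `φ`: for every `x`,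
`π(x) ∈ Argmax_v ((-Δ_N) φ(x) · v - L(x, v))`. -/
def IsArgmaxFeedback {d N : ℕ} [NeZero N] (L : UnitAddTorus (Fin d) → Vel d → ℝ)
    (φ : TorusLattice d N → ℝ) (π : TorusLattice d N → Vel d) : Prop :=
  ∀ x v, pairing (-latticeGrad φ x) v - L (TorusLattice.point x) v ≤
    pairing (-latticeGrad φ x) (π x) - L (TorusLattice.point x) (π x)

/-- The tuple `(Ω, ℱ, P, X, V)` is a controlled Markov chain process for `Λ_N` on `[0, ∞)`.
Processes are indexed by `ℝ≥0`; time integrals are Lebesgue integrals over subsets of `[0, ∞) ⊆ ℝ`.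
The joint measurability of `X` gives a meaning to the time integral in the martingale property. -/
structure IsControlledMarkovChain {d N : ℕ} [NeZero N] {Ω : Type*} {m : MeasurableSpace Ω}
    (ℱ : Filtration ℝ≥0 m) (P : Measure Ω) (X : ℝ≥0 → Ω → TorusLattice d N) (V : ℝ≥0 → Ω → Vel d) :
    Prop where
  isProbability : IsProbabilityMeasure P
  adapted : Adapted ℱ X
  measurable : Measurable fun p : ℝ≥0 × Ω => X p.1 p.2
  progressive : IsStronglyProgressive ℱ V
  integrable : ∀ t : ℝ≥0, ∫⁻ ω, (∫⁻ s in Set.Icc (0 : ℝ) t, ‖V s.toNNReal ω‖ₑ) ∂P < ∞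
  martingale : ∀ φ : TorusLattice d N → ℝ, Martingale
    (fun t ω => φ (X t ω) - ∫ s in (0 : ℝ)..t,
      ∑ y, kolmogorov (V s.toNNReal ω) (X s.toNNReal ω) y * φ y) ℱ P

/-- The tuple `(Ω, ℱ, P, X)` is a motion on `[0, ∞)` produced by the stationary feedback `π`. -/
structure IsMotion {d N : ℕ} [NeZero N] {Ω : Type*} {m : MeasurableSpace Ω}
    (ℱ : Filtration ℝ≥0 m) (P : Measure Ω) (π : TorusLattice d N → Vel d)
    (X : ℝ≥0 → Ω → TorusLattice d N) : Prop where
  isProbability : IsProbabilityMeasure P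
  adapted : Adapted ℱ X
  measurable : Measurable fun p : ℝ≥0 × Ω => X p.1 p.2
  integrable : ∀ t : ℝ≥0, ∫⁻ ω, (∫⁻ s in Set.Icc (0 : ℝ) t, ‖π (X s.toNNReal ω)‖ₑ) ∂P < ∞
  martingale : ∀ φ : TorusLattice d N → ℝ, Martingale
    (fun t ω => φ (X t ω) - ∫ s in (0 : ℝ)..t,
      ∑ y, kolmogorov (π (X s.toNNReal ω)) (X s.toNNReal ω) y * φ y) ℱ P

/-- The discounted cost `E ∫_0^∞ e^{-λ t} L(X_t, V_t) dt`, as an extended real number: the integral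
of the positive part minus the integral of the negative part. For a Lagrangian (which is bounded
below) and `λ > 0` the latter is finite, while the former may be infinite. -/
def discountedCost {d N : ℕ} [NeZero N] {Ω : Type*} {m : MeasurableSpace Ω}
    (L : UnitAddTorus (Fin d) → Vel d → ℝ) (lam : ℝ) (P : Measure Ω)
    (X : ℝ≥0 → Ω → TorusLattice d N) (V : ℝ≥0 → Ω → Vel d) : EReal :=
  ((∫⁻ ω, (∫⁻ t in Set.Ici (0 : ℝ),
      ENNReal.ofReal
        (Real.exp (-lam * t) *
          L (TorusLattice.point (X t.toNNReal ω)) (V t.toNNReal ω))) ∂P : ℝ≥0∞) : EReal) -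
  ((∫⁻ ω, (∫⁻ t in Set.Ici (0 : ℝ),
      ENNReal.ofReal
        (-(Real.exp (-lam * t) *
          L (TorusLattice.point (X t.toNNReal ω)) (V t.toNNReal ω)))) ∂P : ℝ≥0∞) : EReal)

end

/-! This is dynamic programming on a finite state space. Since the weights `N |v_i|` are
nonnegative, `pairing (latticeGrad φ x) v` is the generator of a jump chain, and the Bellman
equation obeys a maximum principle: evaluation at a maximum point of a difference gives uniqueness
(`bellman_comparison`). For existence, velocities are first restricted to a ball, where the equation
is a fixed-point problem for a contraction (`exists_truncated_bellman`). The solutions are bounded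
independently of the radius, and superlinear growth makes velocities outside a large ball useless
(`exists_isBellmanSolution`).

Optimality is a verification argument. The martingale property describes the evolution of the
expectation of `φ(X_t)`, and integration by parts against `e^{-λt}` gives `discounted_dynkin`. The
Bellman equation bounds the generator term minus `λφ` from below by `-L`, with equality along a
maximizing feedback. Letting the horizon tend to infinity yields `le_discountedCost` and
`discountedCost_eq`.

It remains to construct a motion for a given feedback. Its generator `A` has a Markov semigroup
`e^{tA}`. Discrete chains with a small time step exist by Ionescu-Tulcea, and compactness gives a
limit law on paths over the nonnegative rationals (`exists_rationalChain`). Left limits along dyadic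
times extend the paths to real times. By Borel–Cantelli the values along dyadics from the left and
from the right agree almost surely at each fixed time, so the Markov property survives and the
martingale problem is solved (`IsRationalChain.martingale`). -/

/-! ### Estimates for the pairing and the lattice gradient. -/

theorem pairing_neg {d : ℕ} (ξ : Fin d → ℝ × ℝ) (v : Vel d) : pairing (-ξ) v = -pairing ξ v := by
  simp only [pairing, ← Finset.sum_neg_distrib]
  refine Finset.sum_congr rfl fun i _ => ?_
  simp only [Pi.neg_apply, Prod.fst_neg, Prod.snd_neg]
  ring

theorem continuous_pairing {d : ℕ} (ξ : Fin d → ℝ × ℝ) : Continuous (pairing ξ) := by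
  unfold pairing
  fun_prop

theorem abs_pairing_le {d : ℕ} (ξ : Fin d → ℝ × ℝ) (v : Vel d) :
    |pairing ξ v| ≤ (∑ i, (|(ξ i).1| + |(ξ i).2|)) * ‖v‖ := by
  rw [pairing, Finset.sum_mul]
  refine (Finset.abs_sum_le_sum_abs _ _).trans (Finset.sum_le_sum fun i _ => ?_)
  have hv : |v i| ≤ ‖v‖ := by simpa using PiLp.norm_apply_le v i
  have h1 : |max (v i) 0| ≤ ‖v‖ := by
    rw [abs_of_nonneg (le_max_right _ _)]
    exact max_le ((le_abs_self _).trans hv) (norm_nonneg _)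
  have h2 : |max (-v i) 0| ≤ ‖v‖ := by
    rw [abs_of_nonneg (le_max_right _ _)]
    exact max_le ((neg_le_abs _).trans hv) (norm_nonneg _)
  refine (abs_add_le _ _).trans ?_
  rw [abs_mul, abs_mul, add_mul]
  gcongr

/-- The upwind form, with nonnegative weights in front of the differences of `φ`; every monotonicity
argument rests on it. -/
theorem pairing_latticeGrad {d N : ℕ} [NeZero N] (φ : TorusLattice d N → ℝ)
    (x : TorusLattice d N) (v : Vel d) :
    pairing (latticeGrad φ x) v =
      ∑ i, (N : ℝ) * |v i| * (φ (x + TorusLattice.step (v i) i) - φ x) := by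
  rw [← sum_kolmogorov_mul]
  simp only [kolmogorov, Finset.sum_mul]
  rw [Finset.sum_comm]
  refine Finset.sum_congr rfl fun i _ => ?_
  simp [mul_assoc, ← Finset.mul_sum, sub_mul, Finset.sum_sub_distrib]

theorem abs_pairing_latticeGrad_le {d N : ℕ} [NeZero N] {φ : TorusLattice d N → ℝ} {M : ℝ}
    (hM : ∀ x, |φ x| ≤ M) (x : TorusLattice d N) (v : Vel d) :
    |pairing (latticeGrad φ x) v| ≤ 2 * M * N * d * ‖v‖ := by
  rw [pairing_latticeGrad]
  refine (Finset.abs_sum_le_sum_abs _ _).trans ?_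
  have : ∀ i ∈ (Finset.univ : Finset (Fin d)),
      |(N : ℝ) * |v i| * (φ (x + TorusLattice.step (v i) i) - φ x)| ≤ N * ‖v‖ * (2 * M) := by
    intro i _
    have hv : |v i| ≤ ‖v‖ := by simpa using PiLp.norm_apply_le v i
    have h : |φ (x + TorusLattice.step (v i) i) - φ x| ≤ 2 * M := by
      refine (abs_sub _ _).trans ?_
      linarith [hM x, hM (x + TorusLattice.step (v i) i)]
    rw [abs_mul, abs_mul, abs_abs, Nat.abs_cast]
    gcongr
  refine (Finset.sum_le_sum this).trans (le_of_eq ?_)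
  simp
  ring

/-! ### The Bellman equation: comparison, existence and uniqueness. -/

section Bellman

variable {d N : ℕ} [NeZero N] {L : UnitAddTorus (Fin d) → Vel d → ℝ} {lam : ℝ}

theorem IsLagrangian.continuous_right (hL : IsLagrangian L) (t : UnitAddTorus (Fin d)) :
    Continuous (L t) :=
  hL.continuous.comp (Continuous.prodMk_right t)

/-- Superlinearity with a slope one larger than the growth constant of the pairing bounds the
objective by `-‖v‖ - g`, so it is coercive. -/
theorem IsLagrangian.exists_argmax (hL : IsLagrangian L) (t : UnitAddTorus (Fin d))
    (ξ : Fin d → ℝ × ℝ) : ∃ v₀, ∀ v, pairing ξ v - L t v ≤ pairing ξ v₀ - L t v₀ := by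
  obtain ⟨g, hg⟩ := hL.superlinear (∑ i, (|(ξ i).1| + |(ξ i).2|) + 1) (by positivity)
  refine ((continuous_pairing ξ).sub (hL.continuous_right t)).exists_forall_ge ?_
  have h : Filter.Tendsto (fun v : Vel d => -‖v‖ - g) (Filter.cocompact _) Filter.atBot :=
    Filter.tendsto_atBot_add_const_right _ _
      (Filter.tendsto_neg_atTop_atBot.comp (tendsto_norm_cocompact_atTop (E := Vel d)))
  refine Filter.tendsto_atBot_mono (fun v => ?_) h
  have h1 := (le_abs_self _).trans (abs_pairing_le ξ v)
  have h2 := hg t v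
  simp only [Pi.sub_apply]
  linarith

/-- A real-valued `⨆` is meaningful only for a bounded family; the maximizer supplies the bound. -/
theorem latticeHamiltonian_eq_of_argmax {x : TorusLattice d N} {ξ : Fin d → ℝ × ℝ} {v₀ : Vel d}
    (h : ∀ v, pairing ξ v - L x.point v ≤ pairing ξ v₀ - L x.point v₀) :
    latticeHamiltonian L x ξ = pairing ξ v₀ - L x.point v₀ :=
  le_antisymm (ciSup_le h) (le_ciSup (f := fun v => pairing ξ v - L x.point v)
    ⟨_, Set.forall_mem_range.2 h⟩ v₀)

/-- The Bellman equation as an attained minimum. -/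
theorem isBellmanSolution_iff (hL : IsLagrangian L) (φ : TorusLattice d N → ℝ) :
    IsBellmanSolution L lam φ ↔
      (∀ x v, lam * φ x ≤ pairing (latticeGrad φ x) v + L x.point v) ∧
      ∀ x, ∃ v, lam * φ x = pairing (latticeGrad φ x) v + L x.point v := by
  constructor
  · intro h
    refine ⟨fun x v => ?_, fun x => ?_⟩ <;>
      obtain ⟨v₀, hv₀⟩ := hL.exists_argmax x.point (-latticeGrad φ x) <;>
      have hx := h x <;>
      rw [latticeHamiltonian_eq_of_argmax hv₀] at hx
    · have := hv₀ v
      rw [pairing_neg] at this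
      linarith
    · refine ⟨v₀, ?_⟩
      rw [pairing_neg] at hx
      linarith
  · rintro ⟨h1, h2⟩ x
    obtain ⟨v₀, hv₀⟩ := h2 x
    rw [latticeHamiltonian_eq_of_argmax (v₀ := v₀), pairing_neg]
    · linarith
    · intro v
      rw [pairing_neg, pairing_neg]
      linarith [h1 x v]

theorem IsBellmanSolution.eq_of_argmax {φ : TorusLattice d N → ℝ} (h : IsBellmanSolution L lam φ)
    {π : TorusLattice d N → Vel d} (hπ : IsArgmaxFeedback L φ π) (x : TorusLattice d N) :
    lam * φ x = pairing (latticeGrad φ x) (π x) + L x.point (π x) := by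
  have hx := h x
  rw [latticeHamiltonian_eq_of_argmax (hπ x), pairing_neg] at hx
  linarith

theorem exists_isArgmaxFeedback (hL : IsLagrangian L) (φ : TorusLattice d N → ℝ) :
    ∃ π, IsArgmaxFeedback L φ π := by
  choose π hπ using fun x : TorusLattice d N => hL.exists_argmax x.point (-latticeGrad φ x)
  exact ⟨π, hπ⟩

/-- Comparison principle: a subsolution lies below a supersolution. -/
theorem bellman_comparison (hlam : 0 < lam) {φ ψ : TorusLattice d N → ℝ}
    (hφ : ∀ x v, lam * φ x ≤ pairing (latticeGrad φ x) v + L x.point v)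
    (hψ : ∀ x, ∃ v, lam * ψ x = pairing (latticeGrad ψ x) v + L x.point v) : φ ≤ ψ := by
  obtain ⟨x, hx⟩ := Finite.exists_max fun x => φ x - ψ x
  obtain ⟨v, hv⟩ := hψ x
  -- At a maximum point of `φ - ψ`, every difference of `φ` is at most that of `ψ`.
  have h : pairing (latticeGrad φ x) v ≤ pairing (latticeGrad ψ x) v := by
    rw [pairing_latticeGrad, pairing_latticeGrad]
    refine Finset.sum_le_sum fun i _ => mul_le_mul_of_nonneg_left ?_ (by positivity)
    linarith [hx (x + TorusLattice.step (v i) i)]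
  have h1 : lam * φ x ≤ lam * ψ x := by linarith [hφ x v]
  have h2 := le_of_mul_le_mul_left h1 hlam
  intro y
  linarith [hx y]

/-- The Bellman equation with velocities restricted to a ball. -/
theorem exists_truncated_bellman (hL : IsLagrangian L) (hlam : 0 < lam) {R : ℝ} (hR : 0 ≤ R) :
    ∃ φ : TorusLattice d N → ℝ,
      (∀ x v, ‖v‖ ≤ R → lam * φ x ≤ pairing (latticeGrad φ x) v + L x.point v) ∧
      ∀ x, ∃ v, lam * φ x = pairing (latticeGrad φ x) v + L x.point v := by
  have hmin : ∀ (φ : TorusLattice d N → ℝ) (x : TorusLattice d N), ∃ v₀, ‖v₀‖ ≤ R ∧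
      ∀ v, ‖v‖ ≤ R → pairing (latticeGrad φ x) v₀ + L x.point v₀ ≤
        pairing (latticeGrad φ x) v + L x.point v := by
    intro φ x
    obtain ⟨v₀, hv₀, h⟩ := (isCompact_closedBall (0 : Vel d) R).exists_isMinOn
      ⟨0, by simpa using hR⟩
      (((continuous_pairing (latticeGrad φ x)).add (hL.continuous_right x.point)).continuousOn)
    exact ⟨v₀, by simpa using hv₀, fun v hv => h (by simpa using hv)⟩
  choose m hmR hm using hmin
  -- `c` dominates the total jump rate over the ball. Adding `c φ(x)` to both sides leaves a
  -- nonnegative coefficient at `φ(x)`, so `T` is monotone and contracts with the factor `c / (lam +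
  -- c)`.
  set c : ℝ := N * (d * R) with hc
  have hc0 : 0 ≤ c := by positivity
  have hlc : 0 < lam + c := by positivity
  let T : (TorusLattice d N → ℝ) → TorusLattice d N → ℝ := fun φ x =>
    (lam + c)⁻¹ * (c * φ x + (pairing (latticeGrad φ x) (m φ x) + L x.point (m φ x)))
  have hle : ∀ φ ψ : TorusLattice d N → ℝ, ∀ x,
      T φ x - T ψ x ≤ (lam + c)⁻¹ * c * dist φ ψ := by
    intro φ ψ x
    have hD : ∀ y, φ y - ψ y ≤ dist φ ψ := fun y =>
      (le_abs_self _).trans ((Real.dist_eq _ _).symm.le.trans (dist_le_pi_dist φ ψ y))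
    -- The minimizer for `ψ` is a competitor for `φ`, so a difference of minima is at most the
    -- difference at this one velocity.
    set v := m ψ x
    have hv : ∑ i, (N : ℝ) * |v i| ≤ c := by
      have : ∀ i ∈ (Finset.univ : Finset (Fin d)), (N : ℝ) * |v i| ≤ N * R := fun i _ =>
        mul_le_mul_of_nonneg_left
          ((show |v i| ≤ ‖v‖ by simpa using PiLp.norm_apply_le v i).trans (hmR ψ x)) (by positivity)
      refine (Finset.sum_le_sum this).trans (le_of_eq ?_)
      simp [hc]
      ring
    have h1 : pairing (latticeGrad φ x) v - pairing (latticeGrad ψ x) v ≤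
        (∑ i, (N : ℝ) * |v i|) * (dist φ ψ - (φ x - ψ x)) := by
      rw [pairing_latticeGrad, pairing_latticeGrad, ← Finset.sum_sub_distrib, Finset.sum_mul]
      refine Finset.sum_le_sum fun i _ => ?_
      rw [← mul_sub]
      refine mul_le_mul_of_nonneg_left ?_ (by positivity)
      linarith [hD (x + TorusLattice.step (v i) i)]
    have hx0 : 0 ≤ dist φ ψ - (φ x - ψ x) := sub_nonneg.2 (hD x)
    have h2 : (∑ i, (N : ℝ) * |v i|) * (dist φ ψ - (φ x - ψ x)) ≤
        c * (dist φ ψ - (φ x - ψ x)) :=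
      mul_le_mul_of_nonneg_right hv hx0
    have h3 := hm φ x v (hmR ψ x)
    change (lam + c)⁻¹ * _ - (lam + c)⁻¹ * _ ≤ _
    rw [← mul_sub, mul_assoc _ c (dist φ ψ)]
    refine mul_le_mul_of_nonneg_left ?_ (inv_nonneg.2 hlc.le)
    linarith
  have hK : (lam + c)⁻¹ * c < 1 := by
    rw [inv_mul_lt_iff₀ hlc]
    linarith
  have hK0 : 0 ≤ (lam + c)⁻¹ * c := by positivity
  have hT : ContractingWith (Real.toNNReal ((lam + c)⁻¹ * c)) T := by
    refine ⟨Real.toNNReal_lt_one.2 hK, LipschitzWith.of_dist_le_mul fun φ ψ => ?_⟩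
    rw [dist_pi_le_iff (by positivity)]
    intro x
    have h := hle ψ φ x
    rw [dist_comm] at h
    rw [Real.dist_eq, abs_le, Real.coe_toNNReal _ hK0]
    exact ⟨by linarith, hle φ ψ x⟩
  obtain ⟨φ, hφ⟩ : ∃ φ, T φ = φ := ⟨_, hT.fixedPoint_isFixedPt⟩
  have hfix : ∀ x, lam * φ x = pairing (latticeGrad φ x) (m φ x) + L x.point (m φ x) := by
    intro x
    have h := congrFun hφ x
    change (lam + c)⁻¹ * _ = _ at h
    rw [inv_mul_eq_iff_eq_mul₀ hlc.ne'] at h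
    linarith
  exact ⟨φ, fun x v hv => (hfix x).le.trans (hm φ x v hv), fun x => ⟨_, hfix x⟩⟩

theorem exists_isBellmanSolution (hL : IsLagrangian L) (hlam : 0 < lam) :
    ∃ φ : TorusLattice d N → ℝ, IsBellmanSolution L lam φ := by
  obtain ⟨g₀, hg₀⟩ := hL.superlinear 0 le_rfl
  obtain ⟨y, hy⟩ := Finite.exists_max fun x : TorusLattice d N => L x.point 0
  set K := L y.point 0
  set M : ℝ := (|g₀| + |K|) / lam with hMdef
  have hM0 : 0 ≤ M := by positivity
  -- `M` bounds the truncated solution for every radius: from above by testing `v = 0`, from below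
  -- at a minimum point. The pairing is then at least `-2MNd ‖v‖`, so with this slope the right-hand
  -- side is at least `‖v‖ + g`. Beyond the radius `|K| + |g|` this exceeds `K ≥ lam * φ x`, and the
  -- truncation is invisible.
  obtain ⟨g, hg⟩ := hL.superlinear (2 * M * N * d + 1) (by positivity)
  obtain ⟨φ, h1, h2⟩ := exists_truncated_bellman (N := N) hL hlam
    (R := |K| + |g|) (by positivity)
  have hup : ∀ x, lam * φ x ≤ K := fun x => by
    have := h1 x 0 (by simpa using by positivity)
    simp only [pairing_latticeGrad, PiLp.zero_apply, abs_zero, mul_zero, zero_mul,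
      Finset.sum_const_zero, zero_add] at this
    exact this.trans (hy x)
  have hlow : ∀ x, g₀ ≤ lam * φ x := by
    obtain ⟨x, hx⟩ := Finite.exists_min φ
    obtain ⟨v, hv⟩ := h2 x
    have h0 : 0 ≤ pairing (latticeGrad φ x) v := by
      rw [pairing_latticeGrad]
      exact Finset.sum_nonneg fun i _ => mul_nonneg (by positivity) (sub_nonneg.2 (hx _))
    intro y
    have := mul_le_mul_of_nonneg_left (hx y) hlam.le
    have := hg₀ x.point v
    linarith
  have hM : ∀ x, |φ x| ≤ M := by
    intro x
    have hab : |φ x| * lam = |φ x * lam| := by rw [abs_mul, abs_of_pos hlam]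
    rw [hMdef, le_div_iff₀ hlam, hab, abs_le]
    have := hup x
    have := hlow x
    rw [mul_comm (φ x)]
    constructor
    · linarith [neg_abs_le g₀, abs_nonneg K]
    · linarith [le_abs_self K, abs_nonneg g₀]
  refine ⟨φ, (isBellmanSolution_iff hL φ).2 ⟨fun x v => ?_, h2⟩⟩
  by_cases hv : ‖v‖ ≤ |K| + |g|
  · exact h1 x v hv
  · have h3 := neg_le_of_abs_le (abs_pairing_latticeGrad_le hM x v)
    have h4 := hg x.point v
    have := hup x
    linarith [le_abs_self K, neg_abs_le g]

theorem existsUnique_isBellmanSolution (hL : IsLagrangian L) (hlam : 0 < lam) :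
    ∃! φ : TorusLattice d N → ℝ, IsBellmanSolution L lam φ := by
  obtain ⟨φ, hφ⟩ := exists_isBellmanSolution (N := N) hL hlam
  refine ⟨φ, hφ, fun ψ hψ => ?_⟩
  rw [isBellmanSolution_iff hL] at hφ hψ
  exact le_antisymm (bellman_comparison hlam hψ.1 hφ.2) (bellman_comparison hlam hφ.1 hψ.2)

end Bellman

/-! ### Verification: Dynkin's formula and the discounted cost. -/

theorem MeasureTheory.Integrable.lintegral_ofReal_lt_top {α : Type*} {m : MeasurableSpace α}
    {μ : Measure α} {f : α → ℝ} (hf : Integrable f μ) : ∫⁻ x, ENNReal.ofReal (f x) ∂μ < ∞ :=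
  lt_of_le_of_lt (lintegral_mono fun x => Real.ofReal_le_enorm (f x)) hf.hasFiniteIntegral

/-- Integration by parts in its absolutely continuous form, because `γ` is only integrable and its
primitive is differentiable only almost everywhere. -/
theorem exp_mul_add_integral_sub {γ : ℝ → ℝ} {T : ℝ} (hγ : IntervalIntegrable γ volume 0 T)
    (lam c : ℝ) :
    Real.exp (-lam * T) * (c + ∫ s in (0 : ℝ)..T, γ s) - c =
      ∫ s in (0 : ℝ)..T, Real.exp (-lam * s) * (γ s - lam * (c + ∫ r in (0 : ℝ)..s, γ r)) := by
  have hf : ContDiff ℝ 1 fun s : ℝ => Real.exp (-lam * s) := by fun_prop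
  have hf' : ∀ s, deriv (fun s : ℝ => Real.exp (-lam * s)) s = -lam * Real.exp (-lam * s) := by
    intro s
    have h : HasDerivAt (fun s : ℝ => -lam * s) (-lam) s := by
      simpa using (hasDerivAt_id s).const_mul (-lam)
    rw [h.exp.deriv]
    ring
  have hg0 := hγ.absolutelyContinuousOnInterval_intervalIntegral (c := 0) Set.left_mem_uIcc
  have hg : AbsolutelyContinuousOnInterval (fun t => c + ∫ s in (0 : ℝ)..t, γ s) 0 T :=
    (ContDiffOn.absolutelyContinuousOnInterval contDiffOn_const).add hg0
  have h := AbsolutelyContinuousOnInterval.integral_deriv_mul_eq_sub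
    (hf.contDiffOn.absolutelyContinuousOnInterval (a := 0) (b := T)) hg
  simp only [mul_zero, Real.exp_zero, intervalIntegral.integral_same, add_zero, one_mul] at h
  rw [← h]
  refine intervalIntegral.integral_congr_ae ?_
  filter_upwards [hγ.ae_hasDerivAt_integral] with s hs hmem
  have h1 := (hs (Set.uIoc_subset_uIcc hmem) 0 Set.left_mem_uIcc).const_add c
  rw [hf', h1.deriv]
  ring

/-- A jointly measurable pair of a lattice process and a velocity process that satisfies Dynkin's
formula, with the initial state `z`. -/
structure HasDynkinFormula {d N : ℕ} [NeZero N] {Ω : Type*} [MeasurableSpace Ω]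
    (P : Measure Ω) (X : ℝ≥0 → Ω → TorusLattice d N) (V : ℝ≥0 → Ω → Vel d)
    (z : TorusLattice d N) : Prop where
  isProbability : IsProbabilityMeasure P
  measurable_state : Measurable fun p : ℝ≥0 × Ω => X p.1 p.2
  measurable_velocity : Measurable fun p : ℝ≥0 × Ω => V p.1 p.2
  integrable : ∀ t : ℝ≥0, ∫⁻ ω, (∫⁻ s in Set.Icc (0 : ℝ) t, ‖V s.toNNReal ω‖ₑ) ∂P < ∞
  dynkin : ∀ (φ : TorusLattice d N → ℝ) (t : ℝ≥0),
    ∫ ω, (φ (X t ω) - ∫ s in (0 : ℝ)..t,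
      pairing (latticeGrad φ (X s.toNNReal ω)) (V s.toNNReal ω)) ∂P = φ z

/-- A martingale has constant expectation, and at time zero this one equals `φ z` almost surely. -/
theorem integral_martingale_of_ae_eq {d N : ℕ} [NeZero N] {Ω : Type*} {m : MeasurableSpace Ω}
    {ℱ : Filtration ℝ≥0 m} {P : Measure Ω} [IsProbabilityMeasure P]
    {X : ℝ≥0 → Ω → TorusLattice d N} {z : TorusLattice d N} (hz : ∀ᵐ ω ∂P, X 0 ω = z)
    {V : ℝ≥0 → Ω → Vel d} {φ : TorusLattice d N → ℝ}
    (h : Martingale (fun t ω => φ (X t ω) - ∫ s in (0 : ℝ)..t,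
      ∑ y, kolmogorov (V s.toNNReal ω) (X s.toNNReal ω) y * φ y) ℱ P) (t : ℝ≥0) :
    ∫ ω, (φ (X t ω) - ∫ s in (0 : ℝ)..t,
      pairing (latticeGrad φ (X s.toNNReal ω)) (V s.toNNReal ω)) ∂P = φ z := by
  have h1 := h.setIntegral_eq (zero_le : 0 ≤ t) (MeasurableSet.univ)
  simp only [sum_kolmogorov_mul, Measure.restrict_univ] at h1
  rw [← h1]
  have h2 : ∫ ω, φ z ∂P = φ z := by simp
  rw [← h2]
  refine integral_congr_ae ?_
  filter_upwards [hz] with ω hω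
  simp [hω]

/-- Progressive measurability on `[0, n]` makes `V` frozen after time `n` jointly measurable; the
frozen processes converge pointwise to `V`. -/
theorem MeasureTheory.IsStronglyProgressive.measurable_uncurry {Ω : Type*} {m : MeasurableSpace Ω}
    {ℱ : Filtration ℝ≥0 m} {E : Type*} [TopologicalSpace E] [TopologicalSpace.PseudoMetrizableSpace E]
    [MeasurableSpace E] [BorelSpace E] {V : ℝ≥0 → Ω → E} (h : IsStronglyProgressive ℱ V) :
    Measurable fun p : ℝ≥0 × Ω => V p.1 p.2 := by
  have hn : ∀ n : ℕ, Measurable fun p : ℝ≥0 × Ω => V (min p.1 n) p.2 := by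
    intro n
    have h1 := (h (n : ℝ≥0)).measurable
    have h2 : Measurable fun p : Set.Iic (n : ℝ≥0) × Ω => V p.1 p.2 := by
      refine h1.mono (sup_le_sup le_rfl (MeasurableSpace.comap_mono (ℱ.le _))) le_rfl
    have h3 : Measurable fun p : ℝ≥0 × Ω =>
        ((⟨min p.1 n, Set.mem_Iic.2 (min_le_right _ _)⟩ : Set.Iic (n : ℝ≥0)), p.2) :=
      (Measurable.subtype_mk (measurable_fst.min measurable_const)).prodMk measurable_snd
    exact h2.comp h3
  refine measurable_of_tendsto_metrizable hn (tendsto_pi_nhds.2 fun p => ?_)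
  refine tendsto_const_nhds.congr' ?_
  obtain ⟨n₀, hn₀⟩ := exists_nat_ge p.1
  filter_upwards [Filter.eventually_ge_atTop n₀] with n hnn
  rw [min_eq_left (hn₀.trans (by exact_mod_cast hnn))]

theorem IsControlledMarkovChain.hasDynkinFormula {d N : ℕ} [NeZero N] {Ω : Type*}
    {m : MeasurableSpace Ω} {ℱ : Filtration ℝ≥0 m} {P : Measure Ω}
    {X : ℝ≥0 → Ω → TorusLattice d N} {V : ℝ≥0 → Ω → Vel d} (h : IsControlledMarkovChain ℱ P X V)
    {z : TorusLattice d N} (hz : ∀ᵐ ω ∂P, X 0 ω = z) : HasDynkinFormula P X V z where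
  isProbability := h.isProbability
  measurable_state := h.measurable
  measurable_velocity := h.progressive.measurable_uncurry
  integrable := h.integrable
  dynkin φ t := by
    have := h.isProbability
    exact integral_martingale_of_ae_eq hz (h.martingale φ) t

theorem IsMotion.hasDynkinFormula {d N : ℕ} [NeZero N] {Ω : Type*}
    {m : MeasurableSpace Ω} {ℱ : Filtration ℝ≥0 m} {P : Measure Ω}
    {X : ℝ≥0 → Ω → TorusLattice d N} {π : TorusLattice d N → Vel d} (h : IsMotion ℱ P π X)
    {z : TorusLattice d N} (hz : ∀ᵐ ω ∂P, X 0 ω = z) :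
    HasDynkinFormula P X (fun t ω => π (X t ω)) z where
  isProbability := h.isProbability
  measurable_state := h.measurable
  measurable_velocity := (measurable_of_countable π).comp h.measurable
  integrable := h.integrable
  dynkin φ t := by
    have := h.isProbability
    exact integral_martingale_of_ae_eq hz (V := fun t ω => π (X t ω)) (h.martingale φ) t

namespace HasDynkinFormula

variable {d N : ℕ} [NeZero N] {Ω : Type*} [MeasurableSpace Ω] {P : Measure Ω}
  {X : ℝ≥0 → Ω → TorusLattice d N} {V : ℝ≥0 → Ω → Vel d} {z : TorusLattice d N}

theorem measurable_apply (h : HasDynkinFormula P X V z) {F : TorusLattice d N → Vel d → ℝ}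
    (hF : ∀ x, Measurable (F x)) :
    Measurable fun p : ℝ × Ω => F (X p.1.toNNReal p.2) (V p.1.toNNReal p.2) := by
  have h1 : Measurable fun q : TorusLattice d N × Vel d => F q.1 q.2 :=
    measurable_from_prod_countable_right hF
  have h2 : Measurable fun p : ℝ × Ω => (p.1.toNNReal, p.2) :=
    (measurable_real_toNNReal.comp measurable_fst).prodMk measurable_snd
  exact h1.comp ((h.measurable_state.comp h2).prodMk (h.measurable_velocity.comp h2))

theorem integrable_state (h : HasDynkinFormula P X V z) (φ : TorusLattice d N → ℝ) (t : ℝ≥0) :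
    Integrable (fun ω => φ (X t ω)) P := by
  have := h.isProbability
  obtain ⟨y, hy⟩ := Finite.exists_max fun x => |φ x|
  refine Integrable.of_bound (C := |φ y|) ?_ (.of_forall fun ω => hy _)
  exact ((measurable_of_countable φ).comp
    (h.measurable_state.comp measurable_prodMk_left)).aestronglyMeasurable

theorem integrable_norm_velocity (h : HasDynkinFormula P X V z) (T : ℝ≥0) :
    Integrable (fun p : ℝ × Ω => V p.1.toNNReal p.2)
      ((volume.restrict (Set.Ioc (0 : ℝ) T)).prod P) := by
  have := h.isProbability
  have hm : Measurable fun p : ℝ × Ω => V p.1.toNNReal p.2 :=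
    h.measurable_velocity.comp
      ((measurable_real_toNNReal.comp measurable_fst).prodMk measurable_snd)
  refine ⟨hm.aestronglyMeasurable, ?_⟩
  rw [HasFiniteIntegral, lintegral_prod_symm _ hm.enorm.aemeasurable]
  refine lt_of_le_of_lt (lintegral_mono fun ω => ?_) (h.integrable T)
  exact lintegral_mono' (Measure.restrict_mono Set.Ioc_subset_Icc_self le_rfl) le_rfl

theorem integrable_pairing (h : HasDynkinFormula P X V z) (φ : TorusLattice d N → ℝ) (T : ℝ≥0) :
    Integrable (fun p : ℝ × Ω => pairing (latticeGrad φ (X p.1.toNNReal p.2)) (V p.1.toNNReal p.2))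
      ((volume.restrict (Set.Ioc (0 : ℝ) T)).prod P) := by
  obtain ⟨y, hy⟩ := Finite.exists_max fun x => |φ x|
  refine ((h.integrable_norm_velocity T).norm.const_mul (2 * |φ y| * N * d)).mono'
    (h.measurable_apply fun x => (continuous_pairing _).measurable).aestronglyMeasurable
    (.of_forall fun p => ?_)
  exact abs_pairing_latticeGrad_le hy _ _

theorem integral_state (h : HasDynkinFormula P X V z) (φ : TorusLattice d N → ℝ) (T : ℝ≥0) :
    ∫ ω, φ (X T ω) ∂P = φ z + ∫ s in (0 : ℝ)..T,
      ∫ ω, pairing (latticeGrad φ (X s.toNNReal ω)) (V s.toNNReal ω) ∂P := by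
  have := h.isProbability
  have hi := h.integrable_pairing φ T
  have h1 := h.dynkin φ T
  simp only [intervalIntegral.integral_of_le T.coe_nonneg] at h1 ⊢
  rw [integral_sub (h.integrable_state φ T) hi.integral_prod_right,
    ← integral_integral_swap (f := fun (s : ℝ) ω => pairing (latticeGrad φ (X s.toNNReal ω))
      (V s.toNNReal ω)) hi] at h1
  linarith

/-- After Fubini the expectation of `φ(X_t)` is a deterministic primitive, so discounting needs only
the one-variable formula `exp_mul_add_integral_sub`. -/
theorem discounted_dynkin (h : HasDynkinFormula P X V z) (φ : TorusLattice d N → ℝ) (lam : ℝ)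
    (T : ℝ≥0) :
    Real.exp (-lam * T) * ∫ ω, φ (X T ω) ∂P - φ z = ∫ s in (0 : ℝ)..T, ∫ ω, Real.exp (-lam * s) *
      (pairing (latticeGrad φ (X s.toNNReal ω)) (V s.toNNReal ω) - lam * φ (X s.toNNReal ω)) ∂P := by
  have := h.isProbability
  have hi := h.integrable_pairing φ T
  have hii : IntervalIntegrable (fun s : ℝ => ∫ ω, pairing (latticeGrad φ (X s.toNNReal ω))
      (V s.toNNReal ω) ∂P) volume 0 T := by
    rw [intervalIntegrable_iff_integrableOn_Ioc_of_le T.coe_nonneg]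
    exact hi.integral_prod_left
  rw [h.integral_state φ T, exp_mul_add_integral_sub hii]
  refine intervalIntegral.integral_congr_ae ?_
  -- The pairing is known to be integrable in `ω` only at almost every time.
  have hae := hi.prod_right_ae
  rw [ae_restrict_iff' measurableSet_Ioc] at hae
  filter_upwards [hae] with s hs hsT
  rw [Set.uIoc_of_le T.coe_nonneg] at hsT
  rw [integral_const_mul, integral_sub (hs hsT) ((h.integrable_state φ _).const_mul lam),
    integral_const_mul, h.integral_state φ s.toNNReal, Real.coe_toNNReal _ hsT.1.le]

theorem tendsto_exp_mul_integral (h : HasDynkinFormula P X V z) (φ : TorusLattice d N → ℝ)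
    {lam : ℝ} (hlam : 0 < lam) :
    Filter.Tendsto (fun n : ℕ => Real.exp (-lam * n) * ∫ ω, φ (X n ω) ∂P) Filter.atTop (nhds 0) := by
  have := h.isProbability
  obtain ⟨y, hy⟩ := Finite.exists_max fun x => |φ x|
  have he : Filter.Tendsto (fun n : ℕ => Real.exp (-lam * n)) Filter.atTop (nhds 0) := by
    refine Real.tendsto_exp_atBot.comp ?_
    exact (tendsto_natCast_atTop_atTop).const_mul_atTop_of_neg (by linarith)
  refine squeeze_zero_norm (a := fun n : ℕ => Real.exp (-lam * n) * |φ y|) (fun n => ?_)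
    (by simpa using he.mul_const |φ y|)
  rw [norm_mul, Real.norm_of_nonneg (Real.exp_nonneg _)]
  gcongr
  have := norm_integral_le_of_norm_le_const (μ := P) (f := fun ω => φ (X n ω)) (C := |φ y|)
    (.of_forall fun ω => hy _)
  simpa using this

variable {L : UnitAddTorus (Fin d) → Vel d → ℝ} {lam : ℝ}

theorem measurable_cost (h : HasDynkinFormula P X V z) (hL : IsLagrangian L) (lam : ℝ) :
    Measurable fun p : ℝ × Ω => Real.exp (-lam * p.1) *
      L (X p.1.toNNReal p.2).point (V p.1.toNNReal p.2) :=
  Measurable.mul (by fun_prop) (h.measurable_apply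
    (F := fun x v => L x.point v) fun x => (hL.continuous_right _).measurable)

/-- The discounted cost as an integral over the product space, when it is finite. -/
theorem tendsto_integral_cost (h : HasDynkinFormula P X V z)
    (hint : Integrable (fun p : ℝ × Ω => Real.exp (-lam * p.1) *
      L (X p.1.toNNReal p.2).point (V p.1.toNNReal p.2))
      ((volume.restrict (Set.Ioi (0 : ℝ))).prod P)) :
    Filter.Tendsto (fun n : ℕ => ∫ s in (0 : ℝ)..n, ∫ ω, Real.exp (-lam * s) *
      L (X s.toNNReal ω).point (V s.toNNReal ω) ∂P) Filter.atTop
      (nhds (∫ p, Real.exp (-lam * p.1) * L (X p.1.toNNReal p.2).point (V p.1.toNNReal p.2)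
        ∂((volume.restrict (Set.Ioi (0 : ℝ))).prod P))) := by
  have := h.isProbability
  rw [integral_prod _ hint]
  exact intervalIntegral_tendsto_integral_Ioi 0 hint.integral_prod_left tendsto_natCast_atTop_atTop

theorem integrable_mono_horizon [SFinite P] {f : ℝ × Ω → ℝ}
    (hint : Integrable f ((volume.restrict (Set.Ioi (0 : ℝ))).prod P)) (T : ℝ) :
    Integrable f ((volume.restrict (Set.Ioc (0 : ℝ) T)).prod P) :=
  hint.mono_measure (Measure.prod_mono (Measure.restrict_mono Set.Ioc_subset_Ioi_self le_rfl) le_rfl)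

theorem integrable_generator (h : HasDynkinFormula P X V z) (φ : TorusLattice d N → ℝ)
    (hlam : 0 ≤ lam) (T : ℝ≥0) :
    Integrable (fun p : ℝ × Ω => Real.exp (-lam * p.1) *
      (pairing (latticeGrad φ (X p.1.toNNReal p.2)) (V p.1.toNNReal p.2) -
        lam * φ (X p.1.toNNReal p.2))) ((volume.restrict (Set.Ioc (0 : ℝ) T)).prod P) := by
  have := h.isProbability
  obtain ⟨y, hy⟩ := Finite.exists_max fun x => |φ x|
  have h1 : Integrable (fun p : ℝ × Ω => φ (X p.1.toNNReal p.2))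
      ((volume.restrict (Set.Ioc (0 : ℝ) T)).prod P) := by
    refine Integrable.of_bound (C := |φ y|) ?_ (.of_forall fun ω => hy _)
    exact (h.measurable_apply (F := fun x _ => φ x) fun x => measurable_const).aestronglyMeasurable
  refine ((h.integrable_pairing φ T).sub (h1.const_mul lam)).bdd_mul (c := 1) ?_ ?_
  · exact Measurable.aestronglyMeasurable (by fun_prop)
  · have : ∀ᵐ p ∂((volume.restrict (Set.Ioc (0 : ℝ) T)).prod P), p.1 ∈ Set.Ioc (0 : ℝ) T :=
      Measure.quasiMeasurePreserving_fst.ae (ae_restrict_mem measurableSet_Ioc)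
    filter_upwards [this] with p hp
    rw [Real.norm_of_nonneg (Real.exp_nonneg _), Real.exp_le_one_iff]
    nlinarith [hp.1]

/-- The subsolution inequality bounds the integrand of `discounted_dynkin` below by minus the
discounted running cost; the terminal term vanishes as the horizon grows. -/
theorem le_integral_cost (h : HasDynkinFormula P X V z) (hlam : 0 < lam)
    {φ : TorusLattice d N → ℝ}
    (hφ : ∀ x v, lam * φ x ≤ pairing (latticeGrad φ x) v + L x.point v)
    (hint : Integrable (fun p : ℝ × Ω => Real.exp (-lam * p.1) *
      L (X p.1.toNNReal p.2).point (V p.1.toNNReal p.2))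
      ((volume.restrict (Set.Ioi (0 : ℝ))).prod P)) :
    φ z ≤ ∫ p, Real.exp (-lam * p.1) * L (X p.1.toNNReal p.2).point (V p.1.toNNReal p.2)
      ∂((volume.restrict (Set.Ioi (0 : ℝ))).prod P) := by
  have := h.isProbability
  have hlim := (h.tendsto_integral_cost hint).add (h.tendsto_exp_mul_integral φ hlam)
  rw [add_zero] at hlim
  refine ge_of_tendsto' hlim fun n => ?_
  have h1 := h.discounted_dynkin φ lam n
  simp only [NNReal.coe_natCast] at h1
  have h2 : -∫ s in (0 : ℝ)..n, ∫ ω, Real.exp (-lam * s) *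
      L (X s.toNNReal ω).point (V s.toNNReal ω) ∂P ≤ ∫ s in (0 : ℝ)..n, ∫ ω, Real.exp (-lam * s) *
      (pairing (latticeGrad φ (X s.toNNReal ω)) (V s.toNNReal ω) - lam * φ (X s.toNNReal ω)) ∂P := by
    have hA := integrable_mono_horizon hint n
    have hB := h.integrable_generator φ hlam.le n
    rw [NNReal.coe_natCast] at hB
    rw [intervalIntegral.integral_of_le (by positivity),
      intervalIntegral.integral_of_le (by positivity), ← integral_prod _ hA, ← integral_prod _ hB,
      ← integral_neg]
    refine integral_mono hA.neg hB fun p => ?_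
    change -(_ * _) ≤ _
    rw [← mul_neg]
    refine mul_le_mul_of_nonneg_left ?_ (Real.exp_nonneg _)
    linarith [hφ (X p.1.toNNReal p.2) (V p.1.toNNReal p.2)]
  linarith

theorem integral_cost_eq (h : HasDynkinFormula P X V z) (hlam : 0 < lam)
    {φ : TorusLattice d N → ℝ}
    (hφ : ∀ t ω, lam * φ (X t ω) = pairing (latticeGrad φ (X t ω)) (V t ω) +
      L (X t ω).point (V t ω))
    (hint : Integrable (fun p : ℝ × Ω => Real.exp (-lam * p.1) *
      L (X p.1.toNNReal p.2).point (V p.1.toNNReal p.2))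
      ((volume.restrict (Set.Ioi (0 : ℝ))).prod P)) :
    ∫ p, Real.exp (-lam * p.1) * L (X p.1.toNNReal p.2).point (V p.1.toNNReal p.2)
      ∂((volume.restrict (Set.Ioi (0 : ℝ))).prod P) = φ z := by
  have hlim := (h.tendsto_integral_cost hint).add (h.tendsto_exp_mul_integral φ hlam)
  rw [add_zero] at hlim
  refine tendsto_nhds_unique hlim (tendsto_const_nhds.congr fun n => ?_)
  have h1 := h.discounted_dynkin φ lam n
  simp only [NNReal.coe_natCast] at h1
  have h2 : ∀ s ω, pairing (latticeGrad φ (X s ω)) (V s ω) - lam * φ (X s ω) =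
      -L (X s ω).point (V s ω) := fun s ω => by linarith [hφ s ω]
  simp only [h2, mul_neg, integral_neg, intervalIntegral.integral_neg] at h1
  linarith

theorem discountedCost_eq_lintegral (h : HasDynkinFormula P X V z) (hL : IsLagrangian L)
    (lam : ℝ) :
    discountedCost L lam P X V =
      ((∫⁻ p, ENNReal.ofReal (Real.exp (-lam * p.1) *
        L (X p.1.toNNReal p.2).point (V p.1.toNNReal p.2))
        ∂((volume.restrict (Set.Ioi (0 : ℝ))).prod P) : ℝ≥0∞) : EReal) -
      ((∫⁻ p, ENNReal.ofReal (-(Real.exp (-lam * p.1) *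
        L (X p.1.toNNReal p.2).point (V p.1.toNNReal p.2)))
        ∂((volume.restrict (Set.Ioi (0 : ℝ))).prod P) : ℝ≥0∞) : EReal) := by
  have := h.isProbability
  have hm := h.measurable_cost hL lam
  have hneg : Measurable fun p : ℝ × Ω => -(Real.exp (-lam * p.1) *
      L (X p.1.toNNReal p.2).point (V p.1.toNNReal p.2)) := hm.neg
  rw [discountedCost, lintegral_prod_symm _ hm.ennreal_ofReal.aemeasurable,
    lintegral_prod_symm _ hneg.ennreal_ofReal.aemeasurable,
    Measure.restrict_congr_set Ioi_ae_eq_Ici]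

theorem discountedCost_eq_integral (h : HasDynkinFormula P X V z) (hL : IsLagrangian L)
    (hint : Integrable (fun p : ℝ × Ω => Real.exp (-lam * p.1) *
      L (X p.1.toNNReal p.2).point (V p.1.toNNReal p.2))
      ((volume.restrict (Set.Ioi (0 : ℝ))).prod P)) :
    discountedCost L lam P X V =
      ((∫ p, Real.exp (-lam * p.1) * L (X p.1.toNNReal p.2).point (V p.1.toNNReal p.2)
        ∂((volume.restrict (Set.Ioi (0 : ℝ))).prod P) : ℝ) : EReal) := by
  rw [h.discountedCost_eq_lintegral hL, integral_eq_lintegral_pos_part_sub_lintegral_neg_part hint,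
    EReal.coe_sub, EReal.coe_ennreal_toReal, EReal.coe_ennreal_toReal]
  · exact hint.neg.lintegral_ofReal_lt_top.ne
  · exact hint.lintegral_ofReal_lt_top.ne

theorem integrable_exp_const [IsProbabilityMeasure P] (hlam : 0 < lam) (C : ℝ) :
    Integrable (fun p : ℝ × Ω => Real.exp (-lam * p.1) * C)
      ((volume.restrict (Set.Ioi (0 : ℝ))).prod P) :=
  (Integrable.comp_fst (integrableOn_exp_mul_Ioi (neg_lt_zero.2 hlam) 0) P).mul_const C

/-- `L` is bounded below, so the negative part has a finite integral. Either the positive part is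
infinite and the cost is `⊤`, or the running cost is integrable and `le_integral_cost` applies. -/
theorem le_discountedCost (h : HasDynkinFormula P X V z) (hL : IsLagrangian L) (hlam : 0 < lam)
    {φ : TorusLattice d N → ℝ}
    (hφ : ∀ x v, lam * φ x ≤ pairing (latticeGrad φ x) v + L x.point v) :
    (φ z : EReal) ≤ discountedCost L lam P X V := by
  have := h.isProbability
  obtain ⟨g, hg⟩ := hL.superlinear 0 le_rfl
  have hm := h.measurable_cost hL lam
  have hneg : ∫⁻ p, ENNReal.ofReal (-(Real.exp (-lam * p.1) *
      L (X p.1.toNNReal p.2).point (V p.1.toNNReal p.2)))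
      ∂((volume.restrict (Set.Ioi (0 : ℝ))).prod P) < ∞ := by
    refine lt_of_le_of_lt (lintegral_mono fun p => ENNReal.ofReal_le_ofReal ?_)
      (integrable_exp_const (P := P) hlam (-g)).lintegral_ofReal_lt_top
    rw [← mul_neg]
    refine mul_le_mul_of_nonneg_left ?_ (Real.exp_nonneg _)
    linarith [hg (X p.1.toNNReal p.2).point (V p.1.toNNReal p.2)]
  by_cases hpos : ∫⁻ p, ENNReal.ofReal (Real.exp (-lam * p.1) *
      L (X p.1.toNNReal p.2).point (V p.1.toNNReal p.2))
      ∂((volume.restrict (Set.Ioi (0 : ℝ))).prod P) = ∞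
  · rw [h.discountedCost_eq_lintegral hL, hpos, EReal.coe_ennreal_top, EReal.top_sub]
    · exact le_top
    · exact fun hh => hneg.ne (EReal.coe_ennreal_eq_top_iff.1 hh)
  · have hint : Integrable (fun p : ℝ × Ω => Real.exp (-lam * p.1) *
        L (X p.1.toNNReal p.2).point (V p.1.toNNReal p.2))
        ((volume.restrict (Set.Ioi (0 : ℝ))).prod P) := by
      refine ⟨hm.aestronglyMeasurable, ?_⟩
      have he : ∀ a : ℝ, ‖a‖ₑ = ENNReal.ofReal a + ENNReal.ofReal (-a) := by
        intro a
        rcases le_total 0 a with ha | ha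
        · rw [Real.enorm_of_nonneg ha, ENNReal.ofReal_of_nonpos (by linarith : -a ≤ 0), add_zero]
        · rw [← enorm_neg, Real.enorm_of_nonneg (by linarith : 0 ≤ -a),
            ENNReal.ofReal_of_nonpos ha, zero_add]
      simp only [HasFiniteIntegral, he]
      rw [lintegral_add_left hm.ennreal_ofReal]
      exact ENNReal.add_lt_top.2 ⟨lt_top_iff_ne_top.2 hpos, hneg⟩
    rw [h.discountedCost_eq_integral hL hint, EReal.coe_le_coe_iff]
    exact h.le_integral_cost hlam hφ hint

/-- The state space is finite, so the running cost of a feedback is bounded and its discounted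
integral converges absolutely. -/
theorem discountedCost_eq {π : TorusLattice d N → Vel d}
    (h : HasDynkinFormula P X (fun t ω => π (X t ω)) z) (hL : IsLagrangian L) (hlam : 0 < lam)
    {φ : TorusLattice d N → ℝ}
    (hφ : ∀ x, lam * φ x = pairing (latticeGrad φ x) (π x) + L x.point (π x)) :
    discountedCost L lam P X (fun t ω => π (X t ω)) = (φ z : EReal) := by
  have := h.isProbability
  obtain ⟨y, hy⟩ := Finite.exists_max fun x : TorusLattice d N => |L x.point (π x)|
  have hint : Integrable (fun p : ℝ × Ω => Real.exp (-lam * p.1) *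
      L (X p.1.toNNReal p.2).point (π (X p.1.toNNReal p.2)))
      ((volume.restrict (Set.Ioi (0 : ℝ))).prod P) := by
    refine (integrable_exp_const (P := P) hlam |L y.point (π y)|).mono'
      (h.measurable_cost hL lam).aestronglyMeasurable (.of_forall fun p => ?_)
    rw [norm_mul, Real.norm_of_nonneg (Real.exp_nonneg _)]
    exact mul_le_mul_of_nonneg_left (hy _) (Real.exp_nonneg _)
  rw [h.discountedCost_eq_integral hL hint, h.integral_cost_eq hlam (fun t ω => hφ _) hint]

end HasDynkinFormula

/-! ### Markov semigroups on a finite set. -/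

section Semigroup

variable {S : Type*} [Fintype S]

/-- A generator of a Markov semigroup on a finite set: it annihilates the constants, and it is
nonnegative up to a multiple of the identity. -/
structure IsMarkovGenerator (A : (S → ℝ) →L[ℝ] (S → ℝ)) : Prop where
  map_one : A 1 = 0
  exists_nonneg : ∃ c : ℝ, ∀ φ : S → ℝ, 0 ≤ φ → 0 ≤ A φ + c • φ

/-- The semigroup `e^{tA}` of a generator `A`. -/
noncomputable def markovSemigroup (A : (S → ℝ) →L[ℝ] (S → ℝ)) (t : ℝ) : (S → ℝ) →L[ℝ] (S → ℝ) :=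
  NormedSpace.exp (t • A)

variable {A : (S → ℝ) →L[ℝ] (S → ℝ)}

theorem markovSemigroup_zero : markovSemigroup A 0 = 1 := by
  simp [markovSemigroup]

theorem exp_add_of_commute_clm {B C : (S → ℝ) →L[ℝ] (S → ℝ)} (h : Commute B C) :
    NormedSpace.exp (B + C) = NormedSpace.exp B * NormedSpace.exp C := by
  let _ : NormedAlgebra ℚ ((S → ℝ) →L[ℝ] (S → ℝ)) := NormedAlgebra.restrictScalars ℚ ℝ _
  exact NormedSpace.exp_add_of_commute h

theorem markovSemigroup_add (s t : ℝ) :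
    markovSemigroup A (s + t) = markovSemigroup A s * markovSemigroup A t := by
  rw [markovSemigroup, add_smul, exp_add_of_commute_clm]
  · rfl
  · exact ((Commute.refl A).smul_left s).smul_right t

theorem markovSemigroup_nat_mul (k : ℕ) (t : ℝ) :
    markovSemigroup A (k * t) = markovSemigroup A t ^ k := by
  induction k with
  | zero => simp [markovSemigroup_zero]
  | succ k ih => rw [Nat.cast_succ, add_mul, one_mul, markovSemigroup_add, ih, pow_succ]

theorem hasDerivAt_markovSemigroup (φ : S → ℝ) (t : ℝ) :
    HasDerivAt (fun t => markovSemigroup A t φ) (markovSemigroup A t (A φ)) t :=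
  by
  have h := (hasDerivAt_exp_smul_const A t).clm_apply (hasDerivAt_const t φ)
  rw [map_zero, add_zero] at h
  exact h

theorem continuous_markovSemigroup_apply (φ : S → ℝ) :
    Continuous fun t => markovSemigroup A t φ :=
  continuous_iff_continuousAt.2 fun t => (hasDerivAt_markovSemigroup φ t).continuousAt

theorem IsMarkovGenerator.semigroup_one (hA : IsMarkovGenerator A) (t : ℝ) :
    markovSemigroup A t 1 = 1 := by
  have h : ∀ s, HasDerivAt (fun t => markovSemigroup A t 1) 0 s := fun s => by
    simpa [hA.map_one] using hasDerivAt_markovSemigroup (A := A) 1 s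
  have := is_const_of_deriv_eq_zero (fun s => (h s).differentiableAt) (fun s => (h s).deriv) t 0
  simpa [markovSemigroup_zero] using this

theorem exp_apply_nonneg {B : (S → ℝ) →L[ℝ] (S → ℝ)} (hB : ∀ φ, 0 ≤ φ → 0 ≤ B φ) {φ : S → ℝ}
    (hφ : 0 ≤ φ) : 0 ≤ NormedSpace.exp B φ := by
  have hs : HasSum (fun n : ℕ => ((n.factorial : ℝ)⁻¹ • B ^ n) φ) (NormedSpace.exp B φ) :=
    (NormedSpace.exp_series_hasSum_exp' (𝕂 := ℝ) B).mapL
      (ContinuousLinearMap.apply ℝ (S → ℝ) φ)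
  refine hs.nonneg fun n => ?_
  have hn : 0 ≤ (B ^ n) φ := by
    induction n with
    | zero => simpa using hφ
    | succ n ih =>
      rw [pow_succ']
      exact hB _ ih
  have hc : (0 : ℝ) ≤ (n.factorial : ℝ)⁻¹ := by positivity
  exact fun x => mul_nonneg hc (hn x)

/-- Write `tA = t(A + c) - tc`. The summands commute, the second contributes a positive scalar, and
the exponential of a nonnegative operator is a series of nonnegative operators. -/
theorem IsMarkovGenerator.semigroup_nonneg (hA : IsMarkovGenerator A) {t : ℝ} (ht : 0 ≤ t)
    {φ : S → ℝ} (hφ : 0 ≤ φ) : 0 ≤ markovSemigroup A t φ := by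
  obtain ⟨c, hc⟩ := hA.exists_nonneg
  have h1 : t • A = t • (A + c • 1) + (-(t * c)) • (1 : (S → ℝ) →L[ℝ] (S → ℝ)) := by
    ext φ x
    simp
    ring
  have h2 : NormedSpace.exp ((-(t * c)) • (1 : (S → ℝ) →L[ℝ] (S → ℝ))) =
      Real.exp (-(t * c)) • (1 : (S → ℝ) →L[ℝ] (S → ℝ)) := by
    rw [← Algebra.algebraMap_eq_smul_one, ← Algebra.algebraMap_eq_smul_one,
      ← NormedSpace.algebraMap_exp_comm, Real.exp_eq_exp_ℝ]
  rw [markovSemigroup, h1, exp_add_of_commute_clm ((Commute.one_right _).smul_right _), h2,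
    mul_smul_comm, mul_one, smul_apply]
  refine smul_nonneg (Real.exp_nonneg _) (exp_apply_nonneg (fun ψ hψ => ?_) hφ)
  exact smul_nonneg ht (by simpa using hc ψ hψ)

/-- Positivity applied to the functions `‖φ‖ ± φ`, together with preservation of constants. -/
theorem IsMarkovGenerator.norm_semigroup_le (hA : IsMarkovGenerator A) {t : ℝ} (ht : 0 ≤ t)
    (φ : S → ℝ) : ‖markovSemigroup A t φ‖ ≤ ‖φ‖ := by
  have hb : ∀ x, |φ x| ≤ ‖φ‖ := fun x => norm_le_pi_norm φ x
  have h1 := hA.semigroup_nonneg ht (φ := ‖φ‖ • 1 - φ)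
    (fun x => by simpa using (le_abs_self _).trans (hb x))
  have h2 := hA.semigroup_nonneg ht (φ := ‖φ‖ • 1 + φ)
    (fun x => by simpa [neg_le_iff_add_nonneg] using (neg_le_abs _).trans (hb x))
  rw [map_sub, map_smul, hA.semigroup_one] at h1
  rw [map_add, map_smul, hA.semigroup_one] at h2
  refine (pi_norm_le_iff_of_nonneg (norm_nonneg _)).2 fun x => ?_
  have h1x := h1 x
  have h2x := h2 x
  simp only [Pi.zero_apply, Pi.sub_apply, Pi.add_apply, Pi.smul_apply, Pi.one_apply, smul_eq_mul,
    mul_one] at h1x h2x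
  exact abs_le.2 ⟨by linarith, by linarith⟩

theorem IsMarkovGenerator.norm_semigroup_sub_le (hA : IsMarkovGenerator A) {t : ℝ} (ht : 0 ≤ t)
    (φ : S → ℝ) : ‖markovSemigroup A t φ - φ‖ ≤ ‖A φ‖ * t := by
  have h := norm_image_sub_le_of_norm_deriv_le_segment' (f := fun t => markovSemigroup A t φ)
    (a := 0) (b := t) (C := ‖A φ‖)
    (fun s _ => (hasDerivAt_markovSemigroup φ s).hasDerivWithinAt)
    (fun s hs => hA.norm_semigroup_le hs.1 _) t ⟨ht, le_rfl⟩
  simpa [markovSemigroup_zero] using h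

end Semigroup

/-! ### Discrete-time chains from a transition operator. -/

section DiscreteChain

variable {S : Type} [Fintype S] [DecidableEq S]
  {B : (S → ℝ) →L[ℝ] (S → ℝ)}

theorem clm_apply_eq_sum (φ : S → ℝ) (x : S) : B φ x = ∑ y, φ y * B (Pi.single y 1) x := by
  conv_lhs => rw [← Finset.univ_sum_single φ]
  rw [map_sum, Finset.sum_apply]
  refine Finset.sum_congr rfl fun y _ => ?_
  have : Pi.single y (φ y) = φ y • (Pi.single y 1 : S → ℝ) := by
    rw [← Pi.single_smul, smul_eq_mul, mul_one]
  rw [this, map_smul, Pi.smul_apply, smul_eq_mul]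

theorem pi_single_one_nonneg {S : Type*} [DecidableEq S] (y : S) : (0 : S → ℝ) ≤ Pi.single y 1 := by
  rw [Pi.le_def]
  intro x
  by_cases h : x = y
  · subst h; simp
  · simp [h]

variable [MeasurableSpace S] [MeasurableSingletonClass S]

/-- The transition kernel on a finite set of a nonnegative operator. -/
noncomputable def transitionKernel (B : (S → ℝ) →L[ℝ] (S → ℝ)) : Kernel S S where
  toFun x := ∑ y, ENNReal.ofReal (B (Pi.single y 1) x) • Measure.dirac y
  measurable' := measurable_of_countable _

theorem isMarkovKernel_transitionKernel (hB0 : ∀ φ, 0 ≤ φ → 0 ≤ B φ) (hB1 : B 1 = 1) :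
    IsMarkovKernel (transitionKernel B) := by
  refine ⟨fun x => ⟨?_⟩⟩
  change (∑ y, ENNReal.ofReal (B (Pi.single y 1) x) • Measure.dirac y) Set.univ = 1
  have h := clm_apply_eq_sum (B := B) 1 x
  simp only [hB1, Pi.one_apply, one_mul] at h
  simp only [Measure.coe_finsetSum, Finset.sum_apply, Measure.smul_apply, measure_univ,
    smul_eq_mul, mul_one]
  rw [← ENNReal.ofReal_sum_of_nonneg fun y _ => hB0 _ (pi_single_one_nonneg y) x, ← h,
    ENNReal.ofReal_one]

theorem integral_transitionKernel (hB0 : ∀ φ, 0 ≤ φ → 0 ≤ B φ) (φ : S → ℝ) (x : S) :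
    ∫ y, φ y ∂(transitionKernel B x) = B φ x := by
  change ∫ y, φ y ∂(∑ y, ENNReal.ofReal (B (Pi.single y 1) x) • Measure.dirac y) = _
  rw [integral_finsetSum_measure, clm_apply_eq_sum]
  · refine Finset.sum_congr rfl fun y _ => ?_
    rw [integral_smul_measure, integral_dirac,
      ENNReal.toReal_ofReal (hB0 _ (pi_single_one_nonneg y) x), smul_eq_mul, mul_comm]
  · intro y _
    exact (integrable_dirac (by simp)).smul_measure ENNReal.ofReal_ne_top

/-- A Markov chain on `ℕ` with the transition operator `B`. -/
theorem exists_discreteChain (hB0 : ∀ φ, 0 ≤ φ → 0 ≤ B φ) (hB1 : B 1 = 1) (z : S) :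
    ∃ μ : Measure (ℕ → S), IsProbabilityMeasure μ ∧ (∀ᵐ ω ∂μ, ω 0 = z) ∧
      ∀ (a k : ℕ) (E : Set (ℕ → S)), MeasurableSet[Filtration.piLE (X := fun _ : ℕ => S) a] E →
        ∀ φ : S → ℝ, ∫ ω in E, φ (ω (a + k)) ∂μ = ∫ ω in E, (B ^ k) φ (ω a) ∂μ := by
  have := isMarkovKernel_transitionKernel hB0 hB1
  -- Ionescu-Tulcea kernels that see only the last coordinate of the history.
  let κ : (n : ℕ) → Kernel ((i : Finset.Iic n) → S) S := fun n =>
    (transitionKernel B).comap (fun h => h ⟨n, Finset.mem_Iic.2 le_rfl⟩) (measurable_pi_apply _)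
  have hκ : ∀ n, IsMarkovKernel (κ n) := fun n => by dsimp only [κ]; infer_instance
  let x₀ : (i : Finset.Iic 0) → S := fun _ => z
  let μ : Measure (ℕ → S) := Kernel.traj (X := fun _ => S) κ 0 x₀
  have hμ : IsProbabilityMeasure μ := by dsimp only [μ]; infer_instance
  have hint : ∀ (φ : S → ℝ) (n : ℕ), Integrable (fun ω : ℕ → S => φ (ω n)) μ := by
    intro φ n
    obtain ⟨y, hy⟩ := @Finite.exists_max S ℝ _ ⟨z⟩ _ fun x => |φ x|
    refine Integrable.of_bound (C := |φ y|) ?_ (.of_forall fun ω => hy _)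
    exact ((measurable_of_countable φ).comp (measurable_pi_apply n)).aestronglyMeasurable
  have hone : ∀ (a : ℕ) (E : Set (ℕ → S)),
      MeasurableSet[Filtration.piLE (X := fun _ : ℕ => S) a] E →
      ∀ φ : S → ℝ, ∫ ω in E, φ (ω (a + 1)) ∂μ = ∫ ω in E, B φ (ω a) ∂μ := by
    intro a E hE φ
    have hle := (Filtration.piLE (X := fun _ : ℕ => S)).le a
    rw [← setIntegral_condExp hle (hint φ (a + 1)) hE]
    refine setIntegral_congr_ae (hle _ hE) ?_
    have hc := Kernel.condExp_traj (X := fun _ => S) (κ := κ) (Nat.zero_le a) (x₀ := x₀)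
      (f := fun ω => φ (ω (a + 1))) (hint φ (a + 1))
    filter_upwards [hc] with ω hω _
    refine hω.trans ?_
    have h1 : ∫ y, φ (y (a + 1)) ∂(Kernel.traj (X := fun _ => S) κ a (Preorder.frestrictLe a ω)) =
        ∫ y, φ y ∂((Kernel.traj (X := fun _ => S) κ a).map (fun x => x (a + 1))
          (Preorder.frestrictLe a ω)) := by
      rw [Kernel.map_apply _ (measurable_pi_apply _), integral_map
        (measurable_pi_apply _).aemeasurable (measurable_of_countable φ).aestronglyMeasurable]
    rw [h1, Kernel.map_traj_succ_self]
    exact integral_transitionKernel hB0 φ (ω a)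
  refine ⟨μ, hμ, ?_, fun a k E hE => ?_⟩
  · have h : μ.map (Preorder.frestrictLe 0) = Measure.dirac x₀ := by
      rw [Kernel.traj_map_frestrictLe_apply, Kernel.partialTraj_self, Kernel.id_apply]
    have h2 : ∀ᵐ y ∂(μ.map (Preorder.frestrictLe (π := fun _ : ℕ => S) 0)),
        y ⟨0, Finset.mem_Iic.2 le_rfl⟩ = z := by
      rw [h, ae_dirac_eq]
      exact rfl
    exact ae_of_ae_map (by fun_prop) h2
  · induction k with
    | zero => intro φ; simp
    | succ k ih =>
      intro φ
      rw [← add_assoc, hone (a + k) E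
        ((Filtration.piLE (X := fun _ : ℕ => S)).mono (Nat.le_add_right a k) _ hE) φ, ih, pow_succ]
      rfl

end DiscreteChain

/-! ### Cylinder events and their generating systems. -/

/-- Two integrable functions with the same integrals over a `π`-system that generates a
`σ`-algebra have the same integrals over its sets. -/
theorem setIntegral_eq_of_piSystem {Ω : Type*} {m m₀ : MeasurableSpace Ω} {μ : Measure Ω}
    (hm : m ≤ m₀) {C : Set (Set Ω)} (hC : IsPiSystem C) (hgen : m = MeasurableSpace.generateFrom C)
    {f g : Ω → ℝ} (hf : Integrable f μ) (hg : Integrable g μ) (huniv : ∫ ω, f ω ∂μ = ∫ ω, g ω ∂μ)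
    (h : ∀ E ∈ C, ∫ ω in E, f ω ∂μ = ∫ ω in E, g ω ∂μ) (E : Set Ω) (hE : MeasurableSet[m] E) :
    ∫ ω in E, f ω ∂μ = ∫ ω in E, g ω ∂μ := by
  induction E, hE using MeasurableSpace.induction_on_inter hgen hC with
  | empty => simp
  | basic t ht => exact h t ht
  | compl t ht ih =>
    have h1 := integral_add_compl (hm _ ht) hf
    have h2 := integral_add_compl (hm _ ht) hg
    linarith
  | iUnion F hd hF ih =>
    rw [integral_iUnion (fun i => hm _ (hF i)) hd hf.integrableOn,
      integral_iUnion (fun i => hm _ (hF i)) hd hg.integrableOn]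
    simp only [ih]

theorem measurable_piLE_apply {ι S : Type*} [Preorder ι] [MeasurableSpace S] {i j : ι}
    (h : i ≤ j) :
    Measurable[Filtration.piLE (X := fun _ : ι => S) j] fun ω : ι → S => ω i :=
  (measurable_pi_apply (⟨i, h⟩ : Set.Iic j)).comp (comap_measurable (Preorder.restrictLe j))

theorem piLE_eq_iSup {ι S : Type*} [Preorder ι] [MeasurableSpace S] (j : ι) :
    (Filtration.piLE (X := fun _ : ι => S) j : MeasurableSpace (ι → S)) =
      ⨆ i : Set.Iic j, MeasurableSpace.comap (fun ω : ι → S => ω i) inferInstance := by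
  change MeasurableSpace.comap (Preorder.restrictLe j) (⨆ i, _) = _
  rw [MeasurableSpace.comap_iSup]
  simp only [MeasurableSpace.comap_comp]
  rfl

theorem measurable_piLE_iff {ι S Ω : Type*} [Preorder ι] [MeasurableSpace S]
    {m : MeasurableSpace Ω} {j : ι} {f : Ω → ι → S} (hf : ∀ i ≤ j, Measurable fun ω => f ω i) :
    Measurable[m, Filtration.piLE (X := fun _ : ι => S) j] f := by
  rw [measurable_iff_comap_le, piLE_eq_iSup, MeasurableSpace.comap_iSup]
  refine iSup_le fun i => ?_
  rw [MeasurableSpace.comap_comp]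
  exact measurable_iff_comap_le.1 (hf i i.2)

/-- Over a discrete space, events on a single coordinate are clopen. Weak convergence tests only
continuous functions, and the indicators of clopen events are continuous. -/
theorem isPiSystem_clopen_piLE {ι S : Type*} [Preorder ι] [MeasurableSpace S]
    [TopologicalSpace S] [DiscreteTopology S] (p : ι) :
    IsPiSystem {E : Set (ι → S) | IsClopen E ∧
      MeasurableSet[Filtration.piLE (X := fun _ : ι => S) p] E} ∧
    (Filtration.piLE (X := fun _ : ι => S) p : MeasurableSpace (ι → S)) =
      MeasurableSpace.generateFrom {E : Set (ι → S) | IsClopen E ∧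
        MeasurableSet[Filtration.piLE (X := fun _ : ι => S) p] E} := by
  refine ⟨fun E hE F hF _ => ⟨hE.1.inter hF.1, hE.2.inter hF.2⟩, le_antisymm ?_ ?_⟩
  · conv_lhs => rw [piLE_eq_iSup]
    refine iSup_le fun i => ?_
    rintro _ ⟨B, hB, rfl⟩
    refine MeasurableSpace.measurableSet_generateFrom ⟨?_, measurable_piLE_apply i.2 hB⟩
    exact (isClopen_discrete B).preimage (continuous_apply _)
  · exact MeasurableSpace.generateFrom_le fun E hE => hE.2

/-! ### The limit law on paths over the rational times. -/

section RationalChain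

variable {S : Type} [Fintype S] [MeasurableSpace S] [MeasurableSingletonClass S]

theorem integrable_finite_comp {Ω : Type*} {m : MeasurableSpace Ω} {μ : Measure Ω}
    [IsFiniteMeasure μ] {X : Ω → S} (hX : Measurable X) (φ : S → ℝ) :
    Integrable (fun ω => φ (X ω)) μ :=
  Integrable.of_bound (C := ‖φ‖)
    ((measurable_of_countable φ).comp hX).aestronglyMeasurable
    (.of_forall fun ω => norm_le_pi_norm φ (X ω))

/-- The discrete chains with time step `1 / m`, observed at the rational times. -/
theorem exists_gridChain [DecidableEq S] {A : (S → ℝ) →L[ℝ] (S → ℝ)} (hA : IsMarkovGenerator A)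
    (z : S) {m : ℝ} (hm : 0 < m) :
    ∃ μ : Measure (ℚ≥0 → S), IsProbabilityMeasure μ ∧ (∀ᵐ ω ∂μ, ω 0 = z) ∧
      ∀ (p q : ℚ≥0), p ≤ q → ∀ E : Set (ℚ≥0 → S),
        MeasurableSet[Filtration.piLE (X := fun _ : ℚ≥0 => S) p] E → ∀ φ : S → ℝ,
          ∫ ω in E, φ (ω q) ∂μ =
            ∫ ω in E, markovSemigroup A ((⌊q * m⌋₊ : ℝ) / m - (⌊p * m⌋₊ : ℝ) / m) φ (ω p) ∂μ := by
  obtain ⟨μ, hμ, h0, h⟩ := exists_discreteChain (B := markovSemigroup A m⁻¹)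
    (fun φ hφ => hA.semigroup_nonneg (by positivity) hφ) (hA.semigroup_one _) z
  -- The discrete chain is held constant between the grid times `k / m`.
  let F : (ℕ → S) → ℚ≥0 → S := fun ω q => ω ⌊q * m⌋₊
  have hF : Measurable F := measurable_pi_iff.2 fun q => measurable_pi_apply _
  refine ⟨μ.map F, Measure.isProbabilityMeasure_map hF.aemeasurable, ?_, ?_⟩
  · have hz : MeasurableSet {ω : ℚ≥0 → S | ω 0 = z} :=
      (show Measurable fun ω : ℚ≥0 → S => ω 0 from measurable_pi_apply 0)
        (measurableSet_singleton z)
    rw [ae_map_iff hF.aemeasurable hz]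
    filter_upwards [h0] with ω hω
    simpa [F] using hω
  · intro p q hpq E hE φ
    have hpq' : ⌊p * m⌋₊ ≤ ⌊q * m⌋₊ := Nat.floor_mono (by gcongr)
    obtain ⟨k, hk⟩ := Nat.exists_eq_add_of_le hpq'
    have hE' := (Filtration.piLE (X := fun _ : ℚ≥0 => S)).le p E hE
    have hFm : Measurable[Filtration.piLE (X := fun _ : ℕ => S) ⌊p * m⌋₊,
        Filtration.piLE (X := fun _ : ℚ≥0 => S) p] F :=
      measurable_piLE_iff fun r hr => measurable_piLE_apply (Nat.floor_mono (by gcongr))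
    have hmap : ∀ (r : ℚ≥0) (ψ : S → ℝ), ∫ ω in E, ψ (ω r) ∂(μ.map F) =
        ∫ ω in F ⁻¹' E, ψ (F ω r) ∂μ := fun r ψ =>
      setIntegral_map hE' ((measurable_of_countable ψ).comp
        (measurable_pi_apply r)).aestronglyMeasurable hF.aemeasurable
    rw [hmap, hmap]
    have h1 := h ⌊p * m⌋₊ k (F ⁻¹' E) (hFm hE) φ
    rw [← hk, ← markovSemigroup_nat_mul] at h1
    rw [hk]
    have h2 : ((⌊p * m⌋₊ + k : ℕ) : ℝ) / m - (⌊p * m⌋₊ : ℝ) / m = k * m⁻¹ := by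
      push_cast; ring
    rw [h2]
    exact h1

open Filter Topology in
/-- A Markov process with a given generator on a finite set, at the rational times. -/
theorem exists_rationalChain [DecidableEq S] {A : (S → ℝ) →L[ℝ] (S → ℝ)}
    (hA : IsMarkovGenerator A) (z : S) :
    ∃ μ : Measure (ℚ≥0 → S), IsProbabilityMeasure μ ∧ (∀ᵐ ω ∂μ, ω 0 = z) ∧
      ∀ (p q : ℚ≥0), p ≤ q → ∀ E : Set (ℚ≥0 → S),
        MeasurableSet[Filtration.piLE (X := fun _ : ℚ≥0 => S) p] E → ∀ φ : S → ℝ,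
          ∫ ω in E, φ (ω q) ∂μ = ∫ ω in E, markovSemigroup A ((q : ℝ) - p) φ (ω p) ∂μ := by
  let _ : TopologicalSpace S := ⊥
  have _ : DiscreteTopology S := ⟨rfl⟩
  choose ν hν hν0 hνM using fun n : ℕ => exists_gridChain hA z (m := (n : ℝ) + 1) (by positivity)
  let N : ℕ → ProbabilityMeasure (ℚ≥0 → S) := fun n => ⟨ν n, hν n⟩
  -- The path space is a product of finite discrete spaces, hence compact, and so is its space of
  -- probability measures; a limit along an ultrafilter avoids extracting subsequences.
  let U : Ultrafilter ℕ := Ultrafilter.of atTop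
  have hU : (U : Filter ℕ) ≤ atTop := Ultrafilter.of_le atTop
  obtain ⟨μ, hμ⟩ : ∃ μ, Tendsto N U (𝓝 μ) := ⟨_, (U.map N).le_nhds_lim⟩
  rw [ProbabilityMeasure.tendsto_iff_forall_integral_tendsto] at hμ
  have hlim : ∀ g : (ℚ≥0 → S) → ℝ, Continuous g →
      Tendsto (fun n => ∫ ω, g ω ∂(ν n)) U (𝓝 (∫ ω, g ω ∂(μ : Measure (ℚ≥0 → S)))) :=
    fun g hg => hμ (BoundedContinuousFunction.mkOfCompact ⟨g, hg⟩)
  have hcont : ∀ (p : ℚ≥0) (φ : S → ℝ), Continuous fun ω : ℚ≥0 → S => φ (ω p) :=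
    fun p φ => continuous_of_discreteTopology.comp (continuous_apply p)
  refine ⟨μ, inferInstance, ?_, ?_⟩
  · have h1 := hlim _ (hcont 0 fun x => if x = z then 0 else 1)
    have h2 : ∀ n, ∫ ω : ℚ≥0 → S, (if ω 0 = z then (0 : ℝ) else 1) ∂(ν n) = 0 := by
      intro n
      rw [integral_eq_zero_of_ae]
      filter_upwards [hν0 n] with ω hω
      simp [hω]
    simp only [h2] at h1
    have h3 := tendsto_nhds_unique h1 tendsto_const_nhds
    rw [integral_eq_zero_iff_of_nonneg (fun ω => by dsimp only; split_ifs <;> simp)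
      (integrable_finite_comp (X := fun ω : ℚ≥0 → S => ω 0) (measurable_pi_apply 0)
        fun x => if x = z then (0 : ℝ) else 1)] at h3
    filter_upwards [h3] with ω hω
    by_contra hne
    simp [hne] at hω
  · intro p q hpq E hE φ
    have key : ∀ E : Set (ℚ≥0 → S), IsClopen E →
        MeasurableSet[Filtration.piLE (X := fun _ : ℚ≥0 => S) p] E →
        ∫ ω in E, φ (ω q) ∂(μ : Measure (ℚ≥0 → S)) =
          ∫ ω in E, markovSemigroup A ((q : ℝ) - p) φ (ω p) ∂(μ : Measure (ℚ≥0 → S)) := by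
      intro E hEc hE
      have hEm := (Filtration.piLE (X := fun _ : ℚ≥0 => S)).le p E hE
      have hl := hlim _ (hEc.continuous_indicator (hcont q φ))
      have hr := hlim _ (hEc.continuous_indicator (hcont p (markovSemigroup A ((q : ℝ) - p) φ)))
      simp only [integral_indicator hEm] at hl hr
      have hτ : ∀ r : ℚ≥0, Tendsto (fun n : ℕ => (⌊r * ((n : ℝ) + 1)⌋₊ : ℝ) / ((n : ℝ) + 1)) atTop
          (𝓝 (r : ℝ)) := fun r =>
        (tendsto_nat_floor_mul_div_atTop (by positivity)).comp
          (tendsto_atTop_add_const_right _ _ tendsto_natCast_atTop_atTop)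
      have hφ : Tendsto (fun n : ℕ => markovSemigroup A
          ((⌊q * ((n : ℝ) + 1)⌋₊ : ℝ) / ((n : ℝ) + 1) - (⌊p * ((n : ℝ) + 1)⌋₊ : ℝ) / ((n : ℝ) + 1)) φ)
          U (𝓝 (markovSemigroup A ((q : ℝ) - p) φ)) :=
        (((continuous_markovSemigroup_apply φ).tendsto _).comp ((hτ q).sub (hτ p))).mono_left hU
      have hd := tendsto_iff_norm_sub_tendsto_zero.1 hφ
      -- The grid chain has the right transition operator up to rounding of the two times; the error
      -- is bounded by a norm that does not depend on the path.
      have hdiff : Tendsto (fun n => ∫ ω in E, φ (ω q) ∂(ν n) -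
          ∫ ω in E, markovSemigroup A ((q : ℝ) - p) φ (ω p) ∂(ν n)) U (𝓝 0) := by
        refine squeeze_zero_norm (fun n => ?_) hd
        have := hν n
        rw [hνM n p q hpq E hE φ, ← integral_sub
          (integrable_finite_comp (measurable_pi_apply p) _).integrableOn
          (integrable_finite_comp (measurable_pi_apply p) _).integrableOn]
        refine (norm_setIntegral_le_of_norm_le_const (measure_lt_top _ _) fun ω _ => ?_).trans
          (mul_le_of_le_one_right (norm_nonneg _) measureReal_le_one)
        exact norm_le_pi_norm (markovSemigroup A ((⌊q * ((n : ℝ) + 1)⌋₊ : ℝ) / ((n : ℝ) + 1) -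
          (⌊p * ((n : ℝ) + 1)⌋₊ : ℝ) / ((n : ℝ) + 1)) φ - markovSemigroup A ((q : ℝ) - p) φ) (ω p)
      exact sub_eq_zero.1 (tendsto_nhds_unique (hl.sub hr) hdiff)
    obtain ⟨hpi, hgen⟩ := isPiSystem_clopen_piLE (S := S) p
    refine setIntegral_eq_of_piSystem ((Filtration.piLE (X := fun _ : ℚ≥0 => S)).le p) hpi hgen
      (integrable_finite_comp (measurable_pi_apply q) _)
      (integrable_finite_comp (measurable_pi_apply p) _) ?_ (fun E hE => key E hE.1 hE.2) E hE
    simpa using key Set.univ isClopen_univ MeasurableSet.univ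

end RationalChain

/-! ### Dyadic approximation of real times from both sides. -/

section Dyadic

/-- The largest multiple of `2⁻ⁿ` that is at most `t`. -/
noncomputable def dyadicFloor (n : ℕ) (t : ℝ≥0) : ℚ≥0 := (⌊(t : ℝ) * 2 ^ n⌋₊ : ℚ≥0) / 2 ^ n

/-- The smallest multiple of `2⁻ⁿ` that is larger than `t`. -/
noncomputable def dyadicCeil (n : ℕ) (t : ℝ≥0) : ℚ≥0 := dyadicFloor n t + (1 / 2) ^ n

theorem coe_dyadicFloor (n : ℕ) (t : ℝ≥0) :
    (dyadicFloor n t : ℝ) = (⌊(t : ℝ) * 2 ^ n⌋₊ : ℝ) / 2 ^ n := by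
  simp [dyadicFloor]

theorem coe_dyadicCeil (n : ℕ) (t : ℝ≥0) :
    (dyadicCeil n t : ℝ) = dyadicFloor n t + (1 / 2) ^ n := by
  simp [dyadicCeil]

theorem dyadicFloor_le (n : ℕ) (t : ℝ≥0) : (dyadicFloor n t : ℝ) ≤ t := by
  rw [coe_dyadicFloor, div_le_iff₀ (by positivity)]
  exact Nat.floor_le (by positivity)

theorem lt_dyadicCeil (n : ℕ) (t : ℝ≥0) : (t : ℝ) < dyadicCeil n t := by
  rw [coe_dyadicCeil, coe_dyadicFloor, one_div, inv_pow, ← one_div, ← add_div,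
    lt_div_iff₀ (by positivity)]
  exact Nat.lt_floor_add_one _

theorem dyadicFloor_le_succ (n : ℕ) (t : ℝ≥0) : dyadicFloor n t ≤ dyadicFloor (n + 1) t := by
  rw [← NNRat.cast_le (K := ℝ), coe_dyadicFloor, coe_dyadicFloor, pow_succ, ← div_div,
    div_right_comm, div_le_div_iff_of_pos_right (by positivity), le_div_iff₀ (by positivity)]
  have : ⌊(t : ℝ) * 2 ^ n⌋₊ * 2 ≤ ⌊(t : ℝ) * (2 ^ n * 2)⌋₊ := by
    refine Nat.le_floor ?_
    push_cast
    rw [← mul_assoc]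
    exact mul_le_mul_of_nonneg_right (Nat.floor_le (by positivity)) (by norm_num)
  exact_mod_cast this

theorem dyadicFloor_succ_sub_le (n : ℕ) (t : ℝ≥0) :
    (dyadicFloor (n + 1) t : ℝ) - dyadicFloor n t ≤ (1 / 2) ^ n := by
  have h1 := dyadicFloor_le (n + 1) t
  have h2 := lt_dyadicCeil n t
  rw [coe_dyadicCeil] at h2
  linarith

theorem dyadicFloor_le_dyadicCeil (n : ℕ) (t : ℝ≥0) : dyadicFloor n t ≤ dyadicCeil n t :=
  le_self_add

theorem dyadicCeil_mono (n : ℕ) {s t : ℝ≥0} (h : s ≤ t) : dyadicCeil n s ≤ dyadicCeil n t := by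
  unfold dyadicCeil dyadicFloor
  gcongr

open Filter Topology in
theorem tendsto_dyadicCeil (t : ℝ≥0) :
    Tendsto (fun n => (dyadicCeil n t : ℝ)) atTop (𝓝 t) := by
  have h : Tendsto (fun n : ℕ => (t : ℝ) + (1 / 2) ^ n) atTop (𝓝 t) := by
    simpa using (tendsto_pow_atTop_nhds_zero_of_lt_one (r := (1 / 2 : ℝ)) (by norm_num)
      (by norm_num)).const_add (t : ℝ)
  refine tendsto_of_tendsto_of_tendsto_of_le_of_le tendsto_const_nhds h
    (fun n => (lt_dyadicCeil n t).le) fun n => ?_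
  dsimp only
  rw [coe_dyadicCeil]
  linarith [dyadicFloor_le n t]

end Dyadic

/-! ### Measurability of eventual values of sequences. -/

section EventualValue

open Filter

/-- The eventual value of a sequence, or `z` if it is not eventually constant. -/
noncomputable def eventualValue {S : Type*} (z : S) (u : ℕ → S) : S :=
  open Classical in if h : ∃ x, ∀ᶠ n in atTop, u n = x then h.choose else z

theorem eventualValue_eq {S : Type*} {z x : S} {u : ℕ → S} (h : ∀ᶠ n in atTop, u n = x) :
    eventualValue z u = x := by
  have hex : ∃ x, ∀ᶠ n in atTop, u n = x := ⟨x, h⟩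
  rw [eventualValue, dif_pos hex]
  obtain ⟨n, hn1, hn2⟩ := (hex.choose_spec.and h).exists
  exact hn1.symm.trans hn2

theorem measurable_eventualValue {S : Type*} [Countable S] [MeasurableSpace S]
    [MeasurableSingletonClass S] (z : S) : Measurable (eventualValue z) := by
  have hx : ∀ x : S, MeasurableSet {u : ℕ → S | ∀ᶠ n in atTop, u n = x} := by
    intro x
    simp only [eventually_atTop, Set.ofPred_exists, Set.ofPred_forall]
    exact .iUnion fun a => .iInter fun b => .iInter fun _ =>
      (show Measurable fun u : ℕ → S => u b from measurable_pi_apply b) (measurableSet_singleton x)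
  refine measurable_to_countable' fun y => ?_
  -- Sequences that are not eventually constant receive the default `z`, so they belong only to the
  -- fibre over `z`.
  have : eventualValue z ⁻¹' {y} = {u : ℕ → S | ∀ᶠ n in atTop, u n = y} ∪
      ((⋃ x, {u : ℕ → S | ∀ᶠ n in atTop, u n = x})ᶜ ∩ {_u | z = y}) := by
    ext u
    simp only [Set.mem_preimage, Set.mem_singleton_iff, Set.mem_union, Set.mem_ofPred_eq,
      Set.mem_inter_iff, Set.mem_compl_iff, Set.mem_iUnion]
    by_cases h : ∃ x, ∀ᶠ n in atTop, u n = x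
    · obtain ⟨x, hx⟩ := h
      rw [eventualValue_eq hx]
      constructor
      · rintro rfl
        exact Or.inl hx
      · rintro (h | h)
        · obtain ⟨n, hn1, hn2⟩ := (hx.and h).exists
          exact hn1.symm.trans hn2
        · exact absurd ⟨x, hx⟩ h.1
    · have : eventualValue z u = z := by rw [eventualValue, dif_neg h]
      rw [this]
      have h' : ¬ ∀ᶠ n in atTop, u n = y := fun hy => h ⟨y, hy⟩
      simp only [h, h', not_false_eq_true, true_and, false_or]
  rw [this]
  exact (hx y).union ((MeasurableSet.iUnion hx).compl.inter (MeasurableSet.const _))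

/-- Joint measurability of the left dyadic limit of a process indexed by the rationals. -/
theorem measurable_eventualValue_dyadicFloor {S T Ω : Type*} [Countable S] [MeasurableSpace S]
    [MeasurableSingletonClass S] [MeasurableSpace T] {m : MeasurableSpace Ω} (z : S) {c : T → ℝ≥0}
    (hc : Measurable c) {Y : ℚ≥0 → Ω → S}
    (hY : ∀ q : ℚ≥0, (∃ τ, (q : ℝ) ≤ c τ) → Measurable (Y q)) :
    Measurable fun p : T × Ω => eventualValue z fun n => Y (dyadicFloor n (c p.1)) p.2 := by
  refine (measurable_eventualValue z).comp (measurable_pi_iff.2 fun n => ?_)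
  intro B hB
  have hK : Measurable fun τ : T => ⌊(c τ : ℝ) * 2 ^ n⌋₊ := by fun_prop
  -- At a fixed level the dyadic floor takes countably many values, which cuts the preimage into
  -- measurable rectangles. A value that is not attained gives an empty rectangle, so `hY` is needed
  -- only at times below some `c τ`.
  have : (fun p : T × Ω => Y (dyadicFloor n (c p.1)) p.2) ⁻¹' B =
      ⋃ k : ℕ, ((fun τ : T => ⌊(c τ : ℝ) * 2 ^ n⌋₊) ⁻¹' {k}) ×ˢ (Y ((k : ℚ≥0) / 2 ^ n) ⁻¹' B) := by
    ext p
    simp [dyadicFloor]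
  rw [this]
  refine MeasurableSet.iUnion fun k => ?_
  by_cases h : ∃ τ, ⌊(c τ : ℝ) * 2 ^ n⌋₊ = k
  · obtain ⟨τ, hτ⟩ := h
    refine (hK (measurableSet_singleton k)).prod (hY _ ⟨τ, ?_⟩ hB)
    have := dyadicFloor_le n (c τ)
    rwa [dyadicFloor, hτ] at this
  · have : ((fun τ : T => ⌊(c τ : ℝ) * 2 ^ n⌋₊) ⁻¹' {k}) = ∅ := by
      ext τ
      simpa using fun hτ => h ⟨τ, hτ⟩
    rw [this, Set.empty_prod]
    exact MeasurableSet.empty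

end EventualValue

/-! ### Paths at real times and their filtration. -/

section ContinuousTime

variable {S : Type} [MeasurableSpace S]

/-- The filtration on the paths at the rational times: at the real time `t` the coordinates at the
rational times `q ≤ t` are known. -/
def rationalFiltration : Filtration ℝ≥0 (MeasurableSpace.pi : MeasurableSpace (ℚ≥0 → S)) where
  seq t := ⨆ q : {q : ℚ≥0 // (q : ℝ) ≤ t},
    MeasurableSpace.comap (fun ω : ℚ≥0 → S => ω q) inferInstance
  mono' _ _ hst := iSup_le fun q => le_iSup (fun q : {q : ℚ≥0 // (q : ℝ) ≤ _} =>
    MeasurableSpace.comap (fun ω : ℚ≥0 → S => ω q) inferInstance)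
    ⟨q.1, q.2.trans (NNReal.coe_le_coe.2 hst)⟩
  le' _ := iSup_le fun q => measurable_iff_comap_le.1 (measurable_pi_apply q.1)

theorem measurable_rationalFiltration_apply {q : ℚ≥0} {t : ℝ≥0} (h : (q : ℝ) ≤ t) :
    Measurable[rationalFiltration (S := S) t] fun ω : ℚ≥0 → S => ω q :=
  measurable_iff_comap_le.2 (le_iSup (fun q : {q : ℚ≥0 // (q : ℝ) ≤ _} =>
    MeasurableSpace.comap (fun ω : ℚ≥0 → S => ω q) inferInstance) ⟨q, h⟩)

theorem rationalFiltration_le_piLE {q : ℚ≥0} {t : ℝ≥0} (h : (t : ℝ) ≤ q) :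
    (rationalFiltration (S := S) t : MeasurableSpace (ℚ≥0 → S)) ≤
      Filtration.piLE (X := fun _ : ℚ≥0 => S) q :=
  iSup_le fun r => measurable_iff_comap_le.1
    (measurable_piLE_apply (NNRat.cast_le (K := ℝ).1 (r.2.trans h)))

/-- The left dyadic limit of a path at the rational times. -/
noncomputable def dyadicLimit (z : S) (t : ℝ≥0) (ω : ℚ≥0 → S) : S :=
  eventualValue z fun n => ω (dyadicFloor n t)

variable [Countable S] [MeasurableSingletonClass S]

theorem measurable_dyadicLimit (z : S) :
    Measurable fun p : ℝ≥0 × (ℚ≥0 → S) => dyadicLimit z p.1 p.2 :=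
  measurable_eventualValue_dyadicFloor (Y := fun (q : ℚ≥0) (ω : ℚ≥0 → S) => ω q) z measurable_id
    fun q _ => measurable_pi_apply q

/-- A left limit at a time `c τ ≤ t` uses only coordinates up to `t`. Adaptedness, progressive
measurability and measurability of time integrals all come from choices of `T` and `c`. -/
theorem measurable_dyadicLimit_of_le {T : Type*} [MeasurableSpace T] (z : S) {c : T → ℝ≥0}
    (hc : Measurable c) {t : ℝ≥0} (ht : ∀ τ, c τ ≤ t) :
    Measurable[MeasurableSpace.prod inferInstance (rationalFiltration t)]
      fun p : T × (ℚ≥0 → S) => dyadicLimit z (c p.1) p.2 :=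
  measurable_eventualValue_dyadicFloor (m := rationalFiltration t)
    (Y := fun (q : ℚ≥0) (ω : ℚ≥0 → S) => ω q) z hc
    fun _ ⟨τ, hτ⟩ => measurable_rationalFiltration_apply
      (hτ.trans (NNReal.coe_le_coe.2 (ht τ)))

theorem measurable_dyadicLimit_apply (z : S) (t : ℝ≥0) :
    Measurable[rationalFiltration t] (dyadicLimit z t : (ℚ≥0 → S) → S) :=
  (measurable_dyadicLimit_of_le (T := Unit) z (measurable_const (a := t)) fun _ => le_rfl).comp
    (@measurable_prodMk_left _ _ _ (rationalFiltration t) ())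

end ContinuousTime

open Filter Topology in
-- Borel–Cantelli: the probabilities of disagreement are at most `|C| 2⁻ⁿ`.
theorem ae_eventually_eq_of_measure_ne_le {S : Type*} [MeasurableSpace S]
    {μ : Measure (ℚ≥0 → S)} {C : ℝ} (hC : ∀ p q : ℚ≥0, p ≤ q →
      μ {ω | ω p ≠ ω q} ≤ ENNReal.ofReal (C * ((q : ℝ) - p))) {p q : ℕ → ℚ≥0}
    (hpq : ∀ n, p n ≤ q n) (hd : ∀ n, (q n : ℝ) - p n ≤ (1 / 2) ^ n) :
    ∀ᵐ ω ∂μ, ∀ᶠ n in atTop, ω (p n) = ω (q n) := by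
  have hs : Summable fun n : ℕ => |C| * (1 / 2 : ℝ) ^ n :=
    (summable_geometric_of_lt_one (by norm_num) (by norm_num)).mul_left _
  have hsum : ∑' n, μ {ω | ω (p n) ≠ ω (q n)} ≠ ∞ := by
    refine ne_top_of_le_ne_top hs.tsum_ofReal_ne_top (ENNReal.tsum_le_tsum fun n => ?_)
    refine (hC _ _ (hpq n)).trans (ENNReal.ofReal_le_ofReal ?_)
    have h0 : (0 : ℝ) ≤ (q n : ℝ) - p n := sub_nonneg.2 (NNRat.cast_le.2 (hpq n))
    exact mul_le_mul (le_abs_self C) (hd n) h0 (abs_nonneg C)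
  filter_upwards [ae_eventually_notMem hsum] with ω hω
  filter_upwards [hω] with n hn
  simpa using hn

/-! ### The Markov property and the martingale problem at real times. -/

section MarkovProcess

variable {S : Type} [Fintype S] [MeasurableSpace S]
  {A : (S → ℝ) →L[ℝ] (S → ℝ)} {z : S} {μ : Measure (ℚ≥0 → S)}

/-- The law of a Markov process with the generator `A` and the initial state `z`, observed at the
rational times. -/
structure IsRationalChain (A : (S → ℝ) →L[ℝ] (S → ℝ)) (z : S) (μ : Measure (ℚ≥0 → S)) : Prop where
  isProbability : IsProbabilityMeasure μ
  initial : ∀ᵐ ω ∂μ, ω 0 = z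
  markov : ∀ (p q : ℚ≥0), p ≤ q → ∀ E : Set (ℚ≥0 → S),
    MeasurableSet[Filtration.piLE (X := fun _ : ℚ≥0 => S) p] E → ∀ φ : S → ℝ,
      ∫ ω in E, φ (ω q) ∂μ = ∫ ω in E, markovSemigroup A ((q : ℝ) - p) φ (ω p) ∂μ

theorem IsRationalChain.dyadicLimit_zero (h : IsRationalChain A z μ) :
    ∀ᵐ ω ∂μ, dyadicLimit z 0 ω = z := by
  filter_upwards [h.initial] with ω hω
  refine eventualValue_eq (.of_forall fun n => ?_)
  simpa [dyadicFloor] using hω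

variable [MeasurableSingletonClass S]

/-- Split by the state `x` at time `p`. The indicator `ψ x` of having left `x` vanishes at `x`, so
the semigroup value there is at most `‖A (ψ x)‖ (q - p)`. -/
theorem IsRationalChain.exists_measure_ne_le (h : IsRationalChain A z μ)
    (hA : IsMarkovGenerator A) : ∃ C : ℝ, ∀ p q : ℚ≥0, p ≤ q →
      μ {ω | ω p ≠ ω q} ≤ ENNReal.ofReal (C * ((q : ℝ) - p)) := by
  classical
  have := h.isProbability
  let ψ : S → S → ℝ := fun x y => if y = x then 0 else 1
  refine ⟨∑ x, ‖A (ψ x)‖, fun p q hpq => ?_⟩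
  have hpq' : (0 : ℝ) ≤ (q : ℝ) - p := sub_nonneg.2 (NNRat.cast_le.2 hpq)
  have hset : ∀ x, MeasurableSet {ω : ℚ≥0 → S | ω p = x} := fun x =>
    (show Measurable fun ω : ℚ≥0 → S => ω p from measurable_pi_apply p) (measurableSet_singleton x)
  have hset' : ∀ x, MeasurableSet[Filtration.piLE (X := fun _ : ℚ≥0 => S) p]
      {ω : ℚ≥0 → S | ω p = x} := fun x =>
    (measurable_piLE_apply (S := S) (le_refl p)) (measurableSet_singleton x)
  have hq : ∀ x, MeasurableSet {ω : ℚ≥0 → S | ω q ≠ x} := fun x =>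
    ((show Measurable fun ω : ℚ≥0 → S => ω q from measurable_pi_apply q)
      (measurableSet_singleton x)).compl
  have hx : ∀ x, μ.real ({ω | ω p = x} ∩ {ω | ω q ≠ x}) ≤ ‖A (ψ x)‖ * ((q : ℝ) - p) := by
    intro x
    have h1 : μ.real ({ω | ω p = x} ∩ {ω | ω q ≠ x}) = ∫ ω in {ω | ω p = x}, ψ x (ω q) ∂μ := by
      have : (fun ω : ℚ≥0 → S => ψ x (ω q)) = {ω | ω q ≠ x}.indicator fun _ => 1 := by
        ext ω
        by_cases hω : ω q = x <;> simp [ψ, hω]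
      rw [this, setIntegral_indicator (hq x)]
      simp
    rw [h1, h.markov p q hpq _ (hset' x)]
    refine (Real.le_norm_self _).trans ((norm_setIntegral_le_of_norm_le_const
      (C := ‖A (ψ x)‖ * ((q : ℝ) - p)) (measure_lt_top _ _) fun ω hω => ?_).trans
      (mul_le_of_le_one_right (by positivity) measureReal_le_one))
    have h2 : markovSemigroup A ((q : ℝ) - p) (ψ x) (ω p) =
        (markovSemigroup A ((q : ℝ) - p) (ψ x) - ψ x) (ω p) := by
      have h3 : ψ x (ω p) = 0 := if_pos hω
      rw [Pi.sub_apply, h3, sub_zero]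
    rw [h2]
    exact (norm_le_pi_norm _ _).trans (hA.norm_semigroup_sub_le hpq' _)
  rw [← ENNReal.ofReal_toReal (measure_ne_top μ {ω | ω p ≠ ω q})]
  refine ENNReal.ofReal_le_ofReal ?_
  have hsub : {ω : ℚ≥0 → S | ω p ≠ ω q} ⊆ ⋃ x, ({ω | ω p = x} ∩ {ω | ω q ≠ x}) := fun ω hω =>
    Set.mem_iUnion.2 ⟨ω p, rfl, fun h => hω h.symm⟩
  calc μ.real {ω | ω p ≠ ω q} ≤ μ.real (⋃ x, ({ω | ω p = x} ∩ {ω | ω q ≠ x})) :=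
        measureReal_mono hsub
    _ ≤ ∑ x, μ.real ({ω | ω p = x} ∩ {ω | ω q ≠ x}) := measureReal_iUnion_fintype_le _
    _ ≤ ∑ x, ‖A (ψ x)‖ * ((q : ℝ) - p) := Finset.sum_le_sum fun x _ => hx x
    _ = (∑ x, ‖A (ψ x)‖) * ((q : ℝ) - p) := by rw [Finset.sum_mul]

open Filter Topology in
-- Consecutive dyadic floors eventually agree, so the left limit exists; floor and ceiling
-- eventually agree, so the values from the right equal it. The null set depends on `t`, and no path
-- regularity is claimed.
theorem IsRationalChain.ae_eventually_dyadicLimit (h : IsRationalChain A z μ)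
    (hA : IsMarkovGenerator A) (t : ℝ≥0) :
    ∀ᵐ ω ∂μ, ∀ᶠ n in atTop, ω (dyadicCeil n t) = dyadicLimit z t ω := by
  obtain ⟨C, hC⟩ := h.exists_measure_ne_le hA
  filter_upwards [ae_eventually_eq_of_measure_ne_le hC (fun n => dyadicFloor_le_succ n t)
    (fun n => dyadicFloor_succ_sub_le n t), ae_eventually_eq_of_measure_ne_le hC
    (fun n => dyadicFloor_le_dyadicCeil n t) (fun n => by simp [coe_dyadicCeil])] with ω h1 h2
  obtain ⟨n₀, hn₀⟩ := eventually_atTop.1 h1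
  have hconst : ∀ n ≥ n₀, ω (dyadicFloor n t) = ω (dyadicFloor n₀ t) := by
    intro n hn
    induction n, hn using Nat.le_induction with
    | base => rfl
    | succ n hn ih => rw [← hn₀ n hn, ih]
  have hlim : dyadicLimit z t ω = ω (dyadicFloor n₀ t) :=
    eventualValue_eq (eventually_atTop.2 ⟨n₀, hconst⟩)
  filter_upwards [h2, eventually_ge_atTop n₀] with n hn hnn
  rw [← hn, hlim, hconst n hnn]

open Filter Topology in
/-- The Markov property at the real times. -/
theorem IsRationalChain.setIntegral_dyadicLimit (h : IsRationalChain A z μ)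
    (hA : IsMarkovGenerator A) {s t : ℝ≥0} (hst : s ≤ t) {E : Set (ℚ≥0 → S)}
    (hE : MeasurableSet[rationalFiltration s] E) (φ : S → ℝ) :
    ∫ ω in E, φ (dyadicLimit z t ω) ∂μ =
      ∫ ω in E, markovSemigroup A ((t : ℝ) - s) φ (dyadicLimit z s ω) ∂μ := by
  have := h.isProbability
  have hL : Tendsto (fun n => ∫ ω in E, φ (ω (dyadicCeil n t)) ∂μ) atTop
      (𝓝 (∫ ω in E, φ (dyadicLimit z t ω) ∂μ)) := by
    refine tendsto_integral_of_dominated_convergence (fun _ => ‖φ‖) (fun n => ?_)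
      (integrable_const _) (fun n => .of_forall fun ω => norm_le_pi_norm φ _) ?_
    · exact ((measurable_of_countable φ).comp (measurable_pi_apply _)).aestronglyMeasurable
    · filter_upwards [ae_restrict_of_ae (h.ae_eventually_dyadicLimit hA t)] with ω hω
      refine tendsto_const_nhds.congr' ?_
      filter_upwards [hω] with n hn
      rw [hn]
  have hR : Tendsto (fun n => ∫ ω in E, markovSemigroup A
      ((dyadicCeil n t : ℝ) - dyadicCeil n s) φ (ω (dyadicCeil n s)) ∂μ) atTop
      (𝓝 (∫ ω in E, markovSemigroup A ((t : ℝ) - s) φ (dyadicLimit z s ω) ∂μ)) := by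
    refine tendsto_integral_of_dominated_convergence (fun _ => ‖φ‖) (fun n => ?_)
      (integrable_const _) (fun n => .of_forall fun ω => ?_) ?_
    · exact ((measurable_of_countable _).comp (measurable_pi_apply _)).aestronglyMeasurable
    · exact (norm_le_pi_norm _ _).trans (hA.norm_semigroup_le
        (sub_nonneg.2 (NNRat.cast_le.2 (dyadicCeil_mono n hst))) φ)
    · filter_upwards [ae_restrict_of_ae (h.ae_eventually_dyadicLimit hA s)] with ω hω
      have h1 : Tendsto (fun n => markovSemigroup A
          ((dyadicCeil n t : ℝ) - dyadicCeil n s) φ (dyadicLimit z s ω)) atTop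
          (𝓝 (markovSemigroup A ((t : ℝ) - s) φ (dyadicLimit z s ω))) :=
        (((continuous_apply (dyadicLimit z s ω)).comp
          (continuous_markovSemigroup_apply φ)).tendsto _).comp
          ((tendsto_dyadicCeil t).sub (tendsto_dyadicCeil s))
      refine h1.congr' ?_
      filter_upwards [hω] with n hn
      rw [hn]
  -- Approximation from the right is essential: an event known at `s` is then known at the rational
  -- time `dyadicCeil n s`.
  refine tendsto_nhds_unique hL (hR.congr fun n => ?_)
  exact (h.markov _ _ (dyadicCeil_mono n hst) E
    (rationalFiltration_le_piLE (lt_dyadicCeil n s).le E hE) φ).symm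

/-- Integration over `E` is a linear functional on the finite-dimensional space `S → ℝ`, hence
continuous, and commutes with the derivative. -/
theorem hasDerivAt_setIntegral_markovSemigroup {Ω : Type*} {m : MeasurableSpace Ω} {P : Measure Ω}
    [IsFiniteMeasure P] {Y : Ω → S} (hY : Measurable Y) (E : Set Ω) (φ : S → ℝ) (s r : ℝ) :
    HasDerivAt (fun r => ∫ ω in E, markovSemigroup A (r - s) φ (Y ω) ∂P)
      (∫ ω in E, markovSemigroup A (r - s) (A φ) (Y ω) ∂P) r := by
  let l : (S → ℝ) →ₗ[ℝ] ℝ :=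
    { toFun := fun ψ => ∫ ω in E, ψ (Y ω) ∂P
      map_add' := fun ψ χ =>
        integral_add (integrable_finite_comp hY ψ) (integrable_finite_comp hY χ)
      map_smul' := fun c ψ => integral_const_mul c _ }
  have h1 : HasDerivAt (fun r => markovSemigroup A (r - s) φ) (markovSemigroup A (r - s) (A φ)) r :=
    HasDerivAt.comp_sub_const r s (hasDerivAt_markovSemigroup φ (r - s))
  exact l.toContinuousLinearMap.hasFDerivAt.comp_hasDerivAt r h1

/-- The martingale problem, integrated over an event that is known at the initial time. -/
theorem IsRationalChain.setIntegral_sub_eq (h : IsRationalChain A z μ) (hA : IsMarkovGenerator A)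
    {s t : ℝ≥0} (hst : s ≤ t) {E : Set (ℚ≥0 → S)} (hE : MeasurableSet[rationalFiltration s] E)
    (φ : S → ℝ) :
    ∫ ω in E, φ (dyadicLimit z t ω) ∂μ - ∫ ω in E, φ (dyadicLimit z s ω) ∂μ =
      ∫ r in (s : ℝ)..t, ∫ ω in E, A φ (dyadicLimit z r.toNNReal ω) ∂μ := by
  have := h.isProbability
  have hms : Measurable (dyadicLimit z s : (ℚ≥0 → S) → S) :=
    (measurable_dyadicLimit z).comp measurable_prodMk_left
  have hd := fun ψ : S → ℝ => hasDerivAt_setIntegral_markovSemigroup (A := A) (P := μ) hms E ψ s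
  have hft := intervalIntegral.integral_eq_sub_of_hasDerivAt (a := (s : ℝ)) (b := t)
    (fun r _ => hd φ r)
    ((continuous_iff_continuousAt.2 fun r => (hd (A φ) r).continuousAt).intervalIntegrable _ _)
  rw [h.setIntegral_dyadicLimit hA hst hE φ, h.setIntegral_dyadicLimit hA le_rfl hE φ, ← hft]
  refine intervalIntegral.integral_congr fun r hr => ?_
  rw [Set.uIcc_of_le (NNReal.coe_le_coe.2 hst)] at hr
  have hsr : s ≤ r.toNNReal := NNReal.le_toNNReal_of_coe_le hr.1
  rw [h.setIntegral_dyadicLimit hA hsr hE (A φ), Real.coe_toNNReal r (s.coe_nonneg.trans hr.1)]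

theorem measurable_dyadicLimit_real (φ : S → ℝ) (z : S) :
    Measurable fun p : (ℚ≥0 → S) × ℝ => φ (dyadicLimit z p.2.toNNReal p.1) :=
  (measurable_of_countable φ).comp ((measurable_dyadicLimit z).comp
    ((measurable_real_toNNReal.comp measurable_snd).prodMk measurable_fst))

theorem integrable_dyadicLimit_prod [IsFiniteMeasure μ] (φ : S → ℝ) (z : S) (a b : ℝ) :
    Integrable (fun p : (ℚ≥0 → S) × ℝ => φ (dyadicLimit z p.2.toNNReal p.1))
      (μ.prod (volume.restrict (Set.Ioc a b))) :=
  Integrable.of_bound (C := ‖φ‖) (measurable_dyadicLimit_real φ z).aestronglyMeasurable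
    (.of_forall fun _ => norm_le_pi_norm φ _)

theorem intervalIntegrable_dyadicLimit (φ : S → ℝ) (z : S) (ω : ℚ≥0 → S) (a b : ℝ) :
    IntervalIntegrable (fun r : ℝ => φ (dyadicLimit z r.toNNReal ω)) volume a b := by
  refine intervalIntegrable_const.mono_fun' (g := fun _ => ‖φ‖) ?_
    (.of_forall fun r => norm_le_pi_norm φ _)
  exact ((measurable_dyadicLimit_real φ z).comp measurable_prodMk_left).aestronglyMeasurable

theorem stronglyMeasurable_integral_left {Ω : Type*} {m : MeasurableSpace Ω} {f : ℝ × Ω → ℝ}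
    (hf : Measurable f) (ν : Measure ℝ) [SFinite ν] :
    StronglyMeasurable fun ω => ∫ r, f (r, ω) ∂ν :=
  hf.stronglyMeasurable.integral_prod_left'

/-- Capping the time at `t` does not change the integrand on `(0, t]` and makes it jointly
measurable with respect to the information at `t`. -/
theorem stronglyMeasurable_integral_dyadicLimit (φ : S → ℝ) (z : S) (t : ℝ≥0) :
    StronglyMeasurable[rationalFiltration t] fun ω : ℚ≥0 → S =>
      ∫ r in (0 : ℝ)..t, φ (dyadicLimit z r.toNNReal ω) := by
  have hm := (measurable_of_countable φ).comp (measurable_dyadicLimit_of_le (T := ℝ) z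
    (c := fun r => min r.toNNReal t) (by fun_prop) fun r => min_le_right _ _)
  have h2 := stronglyMeasurable_integral_left (m := rationalFiltration t) hm
    (volume.restrict (Set.Ioc (0 : ℝ) t))
  refine (congrArg _ ?_).mp h2
  ext ω
  rw [intervalIntegral.integral_of_le t.coe_nonneg]
  refine setIntegral_congr_fun measurableSet_Ioc fun r hr => ?_
  have : min r.toNNReal t = r.toNNReal :=
    min_eq_left (Real.toNNReal_le_iff_le_coe.2 hr.2)
  simp only [Function.comp_apply, this]

/-- The dyadic limit of a rational chain solves the martingale problem of the generator. -/
theorem IsRationalChain.martingale (h : IsRationalChain A z μ) (hA : IsMarkovGenerator A)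
    (φ : S → ℝ) :
    Martingale (fun (t : ℝ≥0) ω => φ (dyadicLimit z t ω) -
      ∫ r in (0 : ℝ)..t, A φ (dyadicLimit z r.toNNReal ω)) rationalFiltration μ := by
  have := h.isProbability
  have hms : ∀ t, Measurable (dyadicLimit z t : (ℚ≥0 → S) → S) := fun t =>
    (measurable_dyadicLimit z).comp measurable_prodMk_left
  have hi1 : ∀ t, Integrable (fun ω => φ (dyadicLimit z t ω)) μ := fun t =>
    integrable_finite_comp (hms t) φ
  have hi2 : ∀ t : ℝ≥0, Integrable
      (fun ω => ∫ r in (0 : ℝ)..t, A φ (dyadicLimit z r.toNNReal ω)) μ := fun t => by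
    simp only [intervalIntegral.integral_of_le t.coe_nonneg]
    exact (integrable_dyadicLimit_prod (A φ) z 0 t).integral_prod_left
  have hsm : StronglyAdapted rationalFiltration (fun (t : ℝ≥0) ω => φ (dyadicLimit z t ω) -
      ∫ r in (0 : ℝ)..t, A φ (dyadicLimit z r.toNNReal ω)) := by
    intro t
    refine StronglyMeasurable.sub ?_ (stronglyMeasurable_integral_dyadicLimit (A φ) z t)
    exact (((measurable_of_countable φ).comp (measurable_dyadicLimit_apply z t))).stronglyMeasurable
  refine ⟨hsm, fun s t hst => (ae_eq_condExp_of_forall_setIntegral_eq (rationalFiltration.le s)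
    ((hi1 t).sub (hi2 t)) (fun E _ _ => ((hi1 s).sub (hi2 s)).integrableOn) (fun E hE _ => ?_)
    (hsm s).aestronglyMeasurable).symm⟩
  have h1 := h.setIntegral_sub_eq hA hst hE φ
  have h2 : ∫ r in (s : ℝ)..t, ∫ ω in E, A φ (dyadicLimit z r.toNNReal ω) ∂μ =
      ∫ ω in E, (∫ r in (s : ℝ)..t, A φ (dyadicLimit z r.toNNReal ω)) ∂μ := by
    simp only [intervalIntegral.integral_of_le (NNReal.coe_le_coe.2 hst)]
    exact (integral_integral_swap (f := fun ω (r : ℝ) => A φ (dyadicLimit z r.toNNReal ω))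
      (integrable_dyadicLimit_prod (μ := μ.restrict E) (A φ) z s t)).symm
  have h3 : ∫ ω in E, (∫ r in (s : ℝ)..t, A φ (dyadicLimit z r.toNNReal ω)) ∂μ =
      ∫ ω in E, (∫ r in (0 : ℝ)..t, A φ (dyadicLimit z r.toNNReal ω)) ∂μ -
      ∫ ω in E, (∫ r in (0 : ℝ)..s, A φ (dyadicLimit z r.toNNReal ω)) ∂μ := by
    rw [← integral_sub (hi2 t).integrableOn (hi2 s).integrableOn]
    congr 1 with ω
    exact (intervalIntegral.integral_interval_sub_left (intervalIntegrable_dyadicLimit _ _ _ _ _)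
      (intervalIntegrable_dyadicLimit _ _ _ _ _)).symm
  simp only [Pi.sub_apply]
  rw [integral_sub (hi1 s).integrableOn (hi2 s).integrableOn,
    integral_sub (hi1 t).integrableOn (hi2 t).integrableOn]
  linarith

end MarkovProcess

/-! ### Motions produced by a feedback, and the main theorem. -/

section FeedbackMotion

variable {d N : ℕ} [NeZero N]

/-- The generator of the Markov chain on the lattice that is produced by a stationary feedback. -/
noncomputable def feedbackGenerator (π : TorusLattice d N → Vel d) :
    (TorusLattice d N → ℝ) →L[ℝ] (TorusLattice d N → ℝ) :=
  LinearMap.toContinuousLinearMap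
    (Matrix.mulVecLin (Matrix.of fun x y => kolmogorov (π x) x y))

theorem feedbackGenerator_apply (π : TorusLattice d N → Vel d) (φ : TorusLattice d N → ℝ)
    (x : TorusLattice d N) : feedbackGenerator π φ x = ∑ y, kolmogorov (π x) x y * φ y :=
  rfl

/-- The upwind form kills constants, and its only negative contribution is the total jump rate times
`φ x`; the largest such rate serves as `c`. -/
theorem isMarkovGenerator_feedbackGenerator (π : TorusLattice d N → Vel d) :
    IsMarkovGenerator (feedbackGenerator π) where
  map_one := by
    ext x
    rw [feedbackGenerator_apply, sum_kolmogorov_mul, pairing_latticeGrad]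
    simp
  exists_nonneg := by
    obtain ⟨y, hy⟩ := Finite.exists_max fun x : TorusLattice d N => ∑ i, (N : ℝ) * |π x i|
    refine ⟨∑ i, (N : ℝ) * |π y i|, fun φ hφ => fun x => ?_⟩
    rw [Pi.add_apply, feedbackGenerator_apply, sum_kolmogorov_mul, pairing_latticeGrad,
      Pi.smul_apply, smul_eq_mul]
    have h1 : -((∑ i, (N : ℝ) * |π x i|) * φ x) ≤
        ∑ i, (N : ℝ) * |π x i| * (φ (x + TorusLattice.step (π x i) i) - φ x) := by
      rw [Finset.sum_mul, ← Finset.sum_neg_distrib]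
      refine Finset.sum_le_sum fun i _ => ?_
      rw [← mul_neg]
      refine mul_le_mul_of_nonneg_left ?_ (by positivity)
      have := hφ (x + TorusLattice.step (π x i) i)
      simp only [Pi.zero_apply] at this
      linarith
    have h2 := mul_le_mul_of_nonneg_right (hy x) (hφ x)
    simp only [Pi.zero_apply]
    linarith

theorem lintegral_feedback_lt_top {Ω : Type*} {m : MeasurableSpace Ω} {P : Measure Ω}
    [IsFiniteMeasure P] (π : TorusLattice d N → Vel d) (X : ℝ≥0 → Ω → TorusLattice d N) (t : ℝ≥0) :
    ∫⁻ ω, (∫⁻ s in Set.Icc (0 : ℝ) t, ‖π (X s.toNNReal ω)‖ₑ) ∂P < ∞ := by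
  obtain ⟨y, hy⟩ := Finite.exists_max fun x => ‖π x‖
  have h : ∀ x, ‖π x‖ₑ ≤ ‖π y‖ₑ := fun x => enorm_le_iff_norm_le.2 (hy x)
  calc ∫⁻ ω, (∫⁻ s in Set.Icc (0 : ℝ) t, ‖π (X s.toNNReal ω)‖ₑ) ∂P
      ≤ ∫⁻ _, (∫⁻ _ in Set.Icc (0 : ℝ) t, ‖π y‖ₑ) ∂P :=
        lintegral_mono fun ω => lintegral_mono fun s => h _
    _ < ∞ := by
        simp only [lintegral_const, Measure.restrict_apply MeasurableSet.univ, Set.univ_inter,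
          Real.volume_Icc]
        exact ENNReal.mul_lt_top (ENNReal.mul_lt_top enorm_lt_top ENNReal.ofReal_lt_top)
          (measure_lt_top _ _)

/-- Every stationary feedback produces a motion from every initial state. -/
theorem exists_feedback_motion (π : TorusLattice d N → Vel d) (z : TorusLattice d N) :
    ∃ (Ω : Type) (m : MeasurableSpace Ω) (ℱ : Filtration ℝ≥0 m) (P : Measure Ω)
      (X : ℝ≥0 → Ω → TorusLattice d N), IsMotion ℱ P π X ∧ (∀ᵐ ω ∂P, X 0 ω = z) ∧
        IsControlledMarkovChain ℱ P X (fun t ω => π (X t ω)) := by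
  have hA := isMarkovGenerator_feedbackGenerator π
  obtain ⟨μ, hμ, h0, hM⟩ := exists_rationalChain hA z
  have h : IsRationalChain (feedbackGenerator π) z μ := ⟨hμ, h0, hM⟩
  refine ⟨ℚ≥0 → TorusLattice d N, inferInstance, rationalFiltration, μ, dyadicLimit z,
    ⟨hμ, measurable_dyadicLimit_apply z, measurable_dyadicLimit z,
      lintegral_feedback_lt_top π _, h.martingale hA⟩, h.dyadicLimit_zero,
    ⟨hμ, measurable_dyadicLimit_apply z, measurable_dyadicLimit z, fun t => ?_,
      lintegral_feedback_lt_top π _, h.martingale hA⟩⟩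
  have hm := (measurable_of_countable π).comp (measurable_dyadicLimit_of_le z
    (c := fun τ : Set.Iic t => (τ : ℝ≥0)) measurable_subtype_coe fun τ => τ.2)
  exact hm.stronglyMeasurable

end FeedbackMotion

theorem mainTheorem8 (d N : ℕ) [NeZero N] (L : UnitAddTorus (Fin d) → Vel d → ℝ)
    (hL : IsLagrangian L) (lam : ℝ) (hlam : 0 < lam) :
    (∃! φ : TorusLattice d N → ℝ, IsBellmanSolution L lam φ) ∧
    ∀ φ : TorusLattice d N → ℝ, IsBellmanSolution L lam φ →
      -- the maximum in the Hamiltonian is attained at every point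
      (∃ π : TorusLattice d N → Vel d, IsArgmaxFeedback L φ π) ∧
      -- every maximizing stationary feedback attains `φ z`
      (∀ π : TorusLattice d N → Vel d, IsArgmaxFeedback L φ π → ∀ z : TorusLattice d N,
        (∃ (Ω : Type) (m : MeasurableSpace Ω) (ℱ : Filtration ℝ≥0 m) (P : Measure Ω)
          (X : ℝ≥0 → Ω → TorusLattice d N), IsMotion ℱ P π X ∧ (∀ᵐ ω ∂P, X 0 ω = z) ∧
            IsControlledMarkovChain ℱ P X (fun t ω => π (X t ω))) ∧
        ∀ (Ω : Type u) (m : MeasurableSpace Ω) (ℱ : Filtration ℝ≥0 m) (P : Measure Ω)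
          (X : ℝ≥0 → Ω → TorusLattice d N), IsMotion ℱ P π X → (∀ᵐ ω ∂P, X 0 ω = z) →
            discountedCost L lam P X (fun t ω => π (X t ω)) = (φ z : EReal)) ∧
      -- no controlled Markov chain process started at `z` has a smaller cost
      ∀ (z : TorusLattice d N) (Ω : Type u) (m : MeasurableSpace Ω) (ℱ : Filtration ℝ≥0 m)
        (P : Measure Ω) (X : ℝ≥0 → Ω → TorusLattice d N) (V : ℝ≥0 → Ω → Vel d),
        IsControlledMarkovChain ℱ P X V → (∀ᵐ ω ∂P, X 0 ω = z) →
          (φ z : EReal) ≤ discountedCost L lam P X V := by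
  refine ⟨existsUnique_isBellmanSolution hL hlam, fun φ hφ => ⟨exists_isArgmaxFeedback hL φ,
    fun π hπ z => ⟨exists_feedback_motion π z, ?_⟩, ?_⟩⟩
  · intro Ω m ℱ P X hX hz
    exact (hX.hasDynkinFormula hz).discountedCost_eq hL hlam (hφ.eq_of_argmax hπ)
  · intro z Ω m ℱ P X V hXV hz
    exact (hXV.hasDynkinFormula hz).le_discountedCost hL hlam ((isBellmanSolution_iff hL φ).1 hφ).1
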